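/- **Setting.** Let $I\subseteq\mathbb R$ be an interval and let $\mathcal E,\tilde{\mathcal E},\mathcal E_*,\tilde{\mathcal E}_*$ be complex Hilbert spaces. Let $\sigma_1,\sigma_2,\gamma: I\to L(\mathcal E,\tilde{\mathcal E})$ and $\sigma_{1*},\sigma_{2*},\gamma_*: I\to L(\mathcal E_*,\tilde{\mathcal E}_*)$ be such that $\sigma_2,\gamma,\sigma_{2*},\gamma_*$ are in $L^1_{loc}(I)$, and $\sigma_1,\sigma_{1*}$ are (locally) absolutely continuous with boundedly invertible values, all in operator norm. For $\lambda\in\mathbb C$ consider the input and output ODEs $$\lambda\sigma_2u-\sigma_1u'+\gamma u=0,\qquad \lambda\sigma_{2*}y-\sigma_{1*}y'+\gamma_*y=0;$$ solutions are absolutely continuous and satisfy the equation almost everywhere. For $t_2^0\in I$, $\Phi(\lambda,t_2,t_2^0)$ and $\Phi_*(\lambda,t_2,t_2^0)$ denote their fundamental solutions: invertible operator solutions equal to the identity at $t_2=t_2^0$. The class $\mathcal I$ consists of the functions $S(\lambda,t_2)\in L(\mathcal E,\mathcal E_*)$, defined for $t_2\in I$ and $\lambda$ in a neighbourhood $\Omega$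 of $\infty$ not depending on $t_2$, which (1) are analytic at $\lambda=\infty$ for every $t_2$, (2) are absolutely continuous in $t_2$ for almost every $\lambda\in\Omega$, and (3) for every $\lambda\in\Omega$ map solutions $u$ of the input ODE to solutions $y=S(\lambda,\cdot)u$ of the output ODE with the same $\lambda$. A differential vessel with these coefficients consists of a Hilbert space $\mathcal H$ and bounded operators $A_1(t_2),A_2(t_2)\in L(\mathcal H)$, $B(t_2)\in L(\tilde{\mathcal E},\mathcal H)$, $C(t_2)\in L(\mathcal H,\mathcal E_*)$, $D(t_2)\in L(\mathcal E,\mathcal E_*)$, $\tilde D(t_2)\in L(\tilde{\mathcal E},\tilde{\mathcal E}_*)$, with $A_1,B\sigma_1,C,D,\tilde D$ absolutely continuous and $A_2\in L^1_{loc}$, such that for almost every $t_2\in I$ (the derivatives in operator norm existing) $$A_1'=A_2A_1-A_1A_2,\qquad (B\sigma_1)'-A_2B\sigma_1+A_1B\sigma_2+B\gamma=0,$$ $$\sigma_{2*}CA_1-\sigma_{1*}(C'+CA_2)+\gamma_*C=0,$$ $$\sigma_{1*}D=\tilde D\sigma_1,\quad \sigma_{2*}D=\tilde D\sigma_2,\quad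 \tilde D\gamma=\sigma_{2*}CB\sigma_1-\sigma_{1*}CB\sigma_2-\sigma_{1*}D'+\gamma_*D .$$ Its transfer function is $D(t_2)+C(t_2)(\lambda I-A_1(t_2))^{-1}B(t_2)\sigma_1(t_2)$. **Theorem 8.1.** Let $S\in\mathcal I$ and $t_2^0\in I$. Then $\Phi$ and $\Phi_*$ exist, and there are a Hilbert space $\mathcal H$ and bounded operators $A_1\in L(\mathcal H)$, $B_0\in L(\tilde{\mathcal E},\mathcal H)$, $C_0\in L(\mathcal H,\mathcal E_*)$, $D_0\in L(\mathcal E,\mathcal E_*)$ with $$S(\lambda,t_2^0)=D_0+C_0(\lambda I-A_1)^{-1}B_0\sigma_1(t_2^0)\quad\text{for all } \lambda \text{ near } \infty .$$ Moreover, for every such realization there is a differential vessel with state space $\mathcal H$, with $A_1(t_2)=A_1$ constant and $A_2(t_2)=0$ on $I$, and with $$C(t_2)=\frac1{2\pi i}\oint_{\operatorname{Spec}A_1}\Phi_*(\lambda,t_2,t_2^0)\,C_0(\lambda I-A_1)^{-1}\,d\lambda,$$ $$B(t_2)=\frac1{2\pi i}\oint_{\operatorname{Spec}A_1}(\lambda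 I-A_1)^{-1}B_0\,\sigma_1(t_2^0)\,\Phi(\lambda,t_2,t_2^0)^{-1}\sigma_1(t_2)^{-1}\,d\lambda,$$ $$D(t_2)=S(\infty,t_2)=\lim_{\lambda\to\infty}S(\lambda,t_2)$$ (the contour being any positively oriented circle around $\operatorname{Spec}A_1$), whose transfer function is $S$: $$S(\lambda,t_2)=D(t_2)+C(t_2)(\lambda I-A_1)^{-1}B(t_2)\sigma_1(t_2)$$ for all $t_2\in I$ and all $\lambda$ in a neighbourhood of $\infty$ not depending on $t_2$, and also for all $t_2\in I$ at every $\lambda\in\Omega\setminus\operatorname{Spec}A_1$ at which the realization of $S(\lambda,t_2^0)$ above holds. -/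

import Mathlib

open MeasureTheory Filter Topology Bornology

universe uE uEt uEs uEts uH

/-- `f` is (locally) absolutely continuous on the interval `I`: it is absolutely continuous, for the
metric of its target, on every compact interval with endpoints in `I`. -/
def LocallyAC {X : Type*} [PseudoMetricSpace X] (f : ℝ → X) (I : Set ℝ) : Prop :=
  ∀ a ∈ I, ∀ b ∈ I, AbsolutelyContinuousOnInterval f a b

/-- The operator coefficients `σ₁, σ₂, γ : ℝ → L(X, Y)` of the differential equation with spectral
parameter `z`,
`z σ₂(t) u(t) - σ₁(t) u'(t) + γ(t) u(t) = 0`. -/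
structure ODECoeff (X Y : Type*) [NormedAddCommGroup X] [InnerProductSpace ℂ X]
    [NormedAddCommGroup Y] [InnerProductSpace ℂ Y] where
  σ₁ : ℝ → X →L[ℂ] Y
  σ₂ : ℝ → X →L[ℂ] Y
  γ : ℝ → X →L[ℂ] Y

namespace ODECoeff

variable {X Y : Type*} [NormedAddCommGroup X] [InnerProductSpace ℂ X]
  [NormedAddCommGroup Y] [InnerProductSpace ℂ Y]

/-- External regularity on the interval `I`, all in the operator norm: `γ` and `σ₂` are locally
(Bochner) integrable, `σ₁` is absolutely continuous with boundedly invertible values. -/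
structure Regular (p : ODECoeff X Y) (I : Set ℝ) : Prop where
  locallyIntegrable_γ : LocallyIntegrableOn p.γ I volume
  locallyIntegrable_σ₂ : LocallyIntegrableOn p.σ₂ I volume
  locallyAC_σ₁ : LocallyAC p.σ₁ I
  invertible_σ₁ : ∀ t ∈ I, (p.σ₁ t).IsInvertible

/-- `u` is a solution on `I` of `z σ₂ u - σ₁ u' + γ u = 0` (absolutely continuous, equation almost
everywhere). -/
structure IsSolution (p : ODECoeff X Y) (I : Set ℝ) (z : ℂ) (u : ℝ → X) : Prop where
  locallyAC : LocallyAC u I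
  eq : ∀ᵐ t ∂(volume.restrict I), ∃ u' : X, HasDerivAt u u' t ∧
    z • p.σ₂ t (u t) - p.σ₁ t u' + p.γ t (u t) = 0

/-- `Φ z t`, for `z ∈ ℂ` and `t ∈ I`, is the fundamental (matrix or operator) solution `Φ(z, t, t₀)`
of `z σ₂ u - σ₁ u' + γ u = 0`: an operator solution with invertible values and `Φ(z, t₀, t₀) = 1`. -/
structure IsFundamental (p : ODECoeff X Y) (I : Set ℝ) (t₀ : ℝ) (Φ : ℂ → ℝ → X →L[ℂ] X) :
    Prop where
  initial : ∀ z, Φ z t₀ = 1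
  invertible : ∀ z, ∀ t ∈ I, (Φ z t).IsInvertible
  locallyAC : ∀ z, LocallyAC (Φ z) I
  eq : ∀ z, ∀ᵐ t ∂(volume.restrict I), ∃ Φ' : X →L[ℂ] X, HasDerivAt (Φ z) Φ' t ∧
    z • (p.σ₂ t ∘L Φ z t) - p.σ₁ t ∘L Φ' + p.γ t ∘L Φ z t = 0

end ODECoeff

/-- The class of intertwining functions `S(z, t)`, `z ∈ Ω`, `t ∈ I`, attached to the input
coefficients `p = (σ₁, σ₂, γ)` and the output coefficients `q = (σ₁⋆, σ₂⋆, γ⋆)`. The domain `Ω` of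
the spectral variable is a neighbourhood of `∞`. -/
structure IsIntertwining {E Et Es Ets : Type*}
    [NormedAddCommGroup E] [InnerProductSpace ℂ E]
    [NormedAddCommGroup Et] [InnerProductSpace ℂ Et]
    [NormedAddCommGroup Es] [InnerProductSpace ℂ Es]
    [NormedAddCommGroup Ets] [InnerProductSpace ℂ Ets]
    (p : ODECoeff E Et) (q : ODECoeff Es Ets) (I : Set ℝ) (Ω : Set ℂ)
    (S : ℂ → ℝ → E →L[ℂ] Es) : Prop where
  nhds_infty : Ω ∈ cobounded ℂ
  /-- for every `t`, `S(·, t)` is analytic at `z = ∞` -/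
  analytic_infty : ∀ t ∈ I, ∃ g : ℂ → E →L[ℂ] Es,
    AnalyticAt ℂ g 0 ∧ ∀ᶠ z in cobounded ℂ, S z t = g z⁻¹
  /-- for almost every `z`, `S(z, ·)` is absolutely continuous -/
  locallyAC : ∀ᵐ z ∂(volume : Measure ℂ), z ∈ Ω → LocallyAC (S z) I
  /-- `S(z, ·)` maps solutions of the input ODE to solutions of the output ODE with the same
  spectral parameter `z` -/
  maps_solutions : ∀ z ∈ Ω, ∀ u : ℝ → E,
    p.IsSolution I z u → q.IsSolution I z (fun t => S z t (u t))

/-- A vessel in differential form on the interval `I`, with inner space `H`, input coefficients `p`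
and output coefficients `q`. Derivatives exist and the equations hold almost everywhere. -/
structure DifferentialVessel {E Et Es Ets : Type*}
    [NormedAddCommGroup E] [InnerProductSpace ℂ E]
    [NormedAddCommGroup Et] [InnerProductSpace ℂ Et]
    [NormedAddCommGroup Es] [InnerProductSpace ℂ Es]
    [NormedAddCommGroup Ets] [InnerProductSpace ℂ Ets]
    (p : ODECoeff E Et) (q : ODECoeff Es Ets) (I : Set ℝ)
    (H : Type*) [NormedAddCommGroup H] [InnerProductSpace ℂ H] where
  A₁ : ℝ → H →L[ℂ] H
  A₂ : ℝ → H →L[ℂ] H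
  B : ℝ → Et →L[ℂ] H
  C : ℝ → H →L[ℂ] Es
  D : ℝ → E →L[ℂ] Es
  Dt : ℝ → Et →L[ℂ] Ets
  regular_input : p.Regular I
  regular_output : q.Regular I
  locallyAC_A₁ : LocallyAC A₁ I
  locallyIntegrable_A₂ : LocallyIntegrableOn A₂ I volume
  locallyAC_Bσ₁ : LocallyAC (fun t => B t ∘L p.σ₁ t) I
  locallyAC_C : LocallyAC C I
  locallyAC_D : LocallyAC D I
  locallyAC_Dt : LocallyAC Dt I
  /-- Lax equation `A₁' = A₂ A₁ - A₁ A₂` -/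
  lax : ∀ᵐ t ∂(volume.restrict I), HasDerivAt A₁ (A₂ t ∘L A₁ t - A₁ t ∘L A₂ t) t
  /-- input vessel condition `(B σ₁)' - A₂ B σ₁ + A₁ B σ₂ + B γ = 0` -/
  input : ∀ᵐ t ∂(volume.restrict I), ∃ F' : E →L[ℂ] H,
    HasDerivAt (fun s => B s ∘L p.σ₁ s) F' t ∧
    F' - A₂ t ∘L B t ∘L p.σ₁ t + A₁ t ∘L B t ∘L p.σ₂ t + B t ∘L p.γ t = 0
  /-- output vessel condition `σ₂⋆ C A₁ - σ₁⋆ (C' + C A₂) + γ⋆ C = 0` -/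
  output : ∀ᵐ t ∂(volume.restrict I), ∃ C' : H →L[ℂ] Es, HasDerivAt C C' t ∧
    q.σ₂ t ∘L C t ∘L A₁ t - q.σ₁ t ∘L (C' + C t ∘L A₂ t) + q.γ t ∘L C t = 0
  /-- linkage condition `σ₁⋆ D = D̃ σ₁` -/
  linkage₁ : ∀ t ∈ I, q.σ₁ t ∘L D t = Dt t ∘L p.σ₁ t
  /-- linkage condition `σ₂⋆ D = D̃ σ₂` -/
  linkage₂ : ∀ᵐ t ∂(volume.restrict I), q.σ₂ t ∘L D t = Dt t ∘L p.σ₂ t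
  /-- linkage condition `D̃ γ = σ₂⋆ C B σ₁ - σ₁⋆ C B σ₂ - σ₁⋆ D' + γ⋆ D` -/
  linkage₃ : ∀ᵐ t ∂(volume.restrict I), ∃ D' : E →L[ℂ] Es, HasDerivAt D D' t ∧
    Dt t ∘L p.γ t = q.σ₂ t ∘L C t ∘L B t ∘L p.σ₁ t - q.σ₁ t ∘L C t ∘L B t ∘L p.σ₂ t
      - q.σ₁ t ∘L D' + q.γ t ∘L D t

/-- The transfer function `D(t) + C(t) (z - A₁(t))⁻¹ B(t) σ₁(t)` of a differential vessel (for `z`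
outside the spectrum of `A₁(t)`). -/
noncomputable def DifferentialVessel.transferFunction {E Et Es Ets H : Type*}
    [NormedAddCommGroup E] [InnerProductSpace ℂ E]
    [NormedAddCommGroup Et] [InnerProductSpace ℂ Et]
    [NormedAddCommGroup Es] [InnerProductSpace ℂ Es]
    [NormedAddCommGroup Ets] [InnerProductSpace ℂ Ets]
    [NormedAddCommGroup H] [InnerProductSpace ℂ H]
    {p : ODECoeff E Et} {q : ODECoeff Es Ets} {I : Set ℝ}
    (V : DifferentialVessel p q I H) (z : ℂ) (t : ℝ) : E →L[ℂ] Es :=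
  V.D t + V.C t ∘L resolvent (V.A₁ t) z ∘L V.B t ∘L p.σ₁ t

/-- The value at `z` of the transfer function `D₀ + C₀ (z - A₁)⁻¹ B₀ σ` of a constant system. -/
noncomputable def realizationValue {E Et Es H : Type*}
    [NormedAddCommGroup E] [InnerProductSpace ℂ E]
    [NormedAddCommGroup Et] [InnerProductSpace ℂ Et]
    [NormedAddCommGroup Es] [InnerProductSpace ℂ Es]
    [NormedAddCommGroup H] [InnerProductSpace ℂ H]
    (A₁ : H →L[ℂ] H) (B₀ : Et →L[ℂ] H) (C₀ : H →L[ℂ] Es) (D₀ : E →L[ℂ] Es) (σ : E →L[ℂ] Et)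
    (z : ℂ) : E →L[ℂ] Es :=
  D₀ + C₀ ∘L resolvent A₁ z ∘L B₀ ∘L σ

/-! ### Locally absolutely continuous functions -/

/-! Write `K = σ₁⁻¹σ₂`, `N = σ₁⁻¹γ`, and `Ks`, `Ns` for the output side. By uniqueness for the two
ODEs, the intertwining property amounts to `S(z,t) = Φs(z,t) S(z,t₀) Φ(z,t)⁻¹`
(`IsIntertwining.eq_comp`), so everything is determined by the realization at `t₀`.

The vessel operators are not obtained by differentiating contour integrals. `C` and `F = B σ₁` are
the solutions of the linear equations `C' = Ks C A + Ns C` and `F' = -(A F K + F N)`, which are the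
vessel conditions for constant `A₁ = A` and `A₂ = 0`. A conservation law shows that `Φs C₀ (z - A)⁻¹
- C(t) (z - A)⁻¹` extends to an entire function of `z`, and similarly on the input side
(`IsPropagator.exists_entire_output`, `IsPropagator.exists_entire_input`). Since the resolvent
integrates to `2πi`, the contour formulas follow (`inv_smul_circleIntegral_eq`).

Consequently `Φs S(·,t₀) Φ⁻¹` is `C(t) (z - A)⁻¹ F(t)` plus an entire function. Analyticity of
`S(·,t)` at infinity gives this remainder a limit there, so by Liouville it is the constant `D(t) =
S(∞,t)` (`eq_limit_add_transfer`). Differentiating the identity at two distinct values of `z` yields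
the linkage conditions and the absolute continuity of `D` (`feedthrough_equations`).

Two analytic inputs remain: linear ODEs with integrable operator coefficients, solved by a Picard
series that is entire in `z` (`exists_entire_linear_solution`), and the realization of a function
analytic at infinity by a rescaled backward shift on `ℓ²`. -/

namespace LocallyAC

/-- Domination of increments passes to the sums defining absolute continuity. The constant may
depend on the segment, which is what products and inverses require. -/
theorem of_dist_le {X₁ X₂ Y : Type*} [PseudoMetricSpace X₁] [PseudoMetricSpace X₂]
    [PseudoMetricSpace Y] {I : Set ℝ} {f₁ : ℝ → X₁} {f₂ : ℝ → X₂} {g : ℝ → Y}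
    (h₁ : LocallyAC f₁ I) (h₂ : LocallyAC f₂ I)
    (h : ∀ a ∈ I, ∀ b ∈ I, ∃ K : ℝ, ∀ s ∈ Set.uIcc a b, ∀ t ∈ Set.uIcc a b,
      dist (g s) (g t) ≤ K * (dist (f₁ s) (f₁ t) + dist (f₂ s) (f₂ t))) :
    LocallyAC g I := by
  intro a ha b hb
  obtain ⟨K, hK⟩ := h a ha b hb
  have h₁₂ := (Tendsto.add (h₁ a ha b hb) (h₂ a ha b hb)).const_mul K
  rw [add_zero, mul_zero] at h₁₂
  refine squeeze_zero' (Eventually.of_forall fun E => Finset.sum_nonneg fun _ _ => dist_nonneg)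
    ?_ h₁₂
  filter_upwards [mem_inf_of_right (mem_principal_self _)] with E hE
  rw [← Finset.sum_add_distrib, Finset.mul_sum]
  exact Finset.sum_le_sum fun i hi => hK _ (hE.1 i hi).1 _ (hE.1 i hi).2

theorem congr {X : Type*} [PseudoMetricSpace X] {I : Set ℝ} (hI : I.OrdConnected) {f g : ℝ → X}
    (hf : LocallyAC f I) (h : ∀ t ∈ I, g t = f t) : LocallyAC g I := by
  refine hf.of_dist_le hf fun a ha b hb => ⟨1, fun s hs t ht => ?_⟩
  rw [h s (hI.uIcc_subset ha hb hs), h t (hI.uIcc_subset ha hb ht), one_mul]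
  exact le_add_of_nonneg_left dist_nonneg

theorem const {X : Type*} [PseudoMetricSpace X] (I : Set ℝ) (c : X) :
    LocallyAC (fun _ : ℝ => c) I := by
  intro a _ b _
  simpa [AbsolutelyContinuousOnInterval] using tendsto_const_nhds

theorem add {V : Type*} [NormedAddCommGroup V] {I : Set ℝ} {f g : ℝ → V} (hf : LocallyAC f I)
    (hg : LocallyAC g I) : LocallyAC (fun t => f t + g t) I :=
  fun a ha b hb => (hf a ha b hb).fun_add (hg a ha b hb)

theorem sub {V : Type*} [NormedAddCommGroup V] {I : Set ℝ} {f g : ℝ → V} (hf : LocallyAC f I)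
    (hg : LocallyAC g I) : LocallyAC (fun t => f t - g t) I :=
  fun a ha b hb => (hf a ha b hb).fun_sub (hg a ha b hb)

theorem continuousOn_uIcc {V : Type*} [NormedAddCommGroup V] {I : Set ℝ} {f : ℝ → V}
    (hf : LocallyAC f I) {a b : ℝ} (ha : a ∈ I) (hb : b ∈ I) : ContinuousOn f (Set.uIcc a b) :=
  (hf a ha b hb).continuousOn

theorem exists_bound {V : Type*} [NormedAddCommGroup V] {I : Set ℝ} {f : ℝ → V}
    (hf : LocallyAC f I) {a b : ℝ} (ha : a ∈ I) (hb : b ∈ I) :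
    ∃ M, 0 ≤ M ∧ ∀ t ∈ Set.uIcc a b, ‖f t‖ ≤ M := by
  obtain ⟨C, hC⟩ := (hf a ha b hb).exists_bound
  exact ⟨C, (norm_nonneg _).trans (hC a Set.left_mem_uIcc), hC⟩

section Bilinear

variable {V W G : Type*} [NormedAddCommGroup V] [NormedSpace ℂ V] [NormedAddCommGroup W]
  [NormedSpace ℂ W] [NormedAddCommGroup G] [NormedSpace ℂ G]

theorem bilin (T : V →L[ℂ] W →L[ℂ] G) {I : Set ℝ} {f : ℝ → V} {g : ℝ → W}
    (hf : LocallyAC f I) (hg : LocallyAC g I) : LocallyAC (fun t => T (f t) (g t)) I := by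
  refine hf.of_dist_le hg fun a ha b hb => ?_
  obtain ⟨M, hM0, hM⟩ := hf.exists_bound ha hb
  obtain ⟨N, hN0, hN⟩ := hg.exists_bound ha hb
  refine ⟨‖T‖ * (M + N), fun s hs t ht => ?_⟩
  have key : T (f s) (g s) - T (f t) (g t) = T (f s) (g s - g t) + T (f s - f t) (g t) := by
    simp only [map_sub, sub_apply]; abel
  rw [dist_eq_norm, dist_eq_norm, dist_eq_norm, key]
  calc ‖T (f s) (g s - g t) + T (f s - f t) (g t)‖
      ≤ ‖T‖ * ‖f s‖ * ‖g s - g t‖ + ‖T‖ * ‖f s - f t‖ * ‖g t‖ :=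
        norm_add_le_of_le (T.le_opNorm₂ _ _) (T.le_opNorm₂ _ _)
    _ ≤ ‖T‖ * (M + N) * ‖g s - g t‖ + ‖T‖ * ‖f s - f t‖ * (M + N) := by
        gcongr
        · linarith [hM s hs]
        · linarith [hN t ht]
    _ = _ := by ring

end Bilinear

section Comp

variable {U V W : Type*} [NormedAddCommGroup U] [NormedSpace ℂ U] [NormedAddCommGroup V]
  [NormedSpace ℂ V] [NormedAddCommGroup W] [NormedSpace ℂ W]

theorem comp {I : Set ℝ} {f : ℝ → V →L[ℂ] W} {g : ℝ → U →L[ℂ] V}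
    (hf : LocallyAC f I) (hg : LocallyAC g I) : LocallyAC (fun t => f t ∘L g t) I :=
  hf.bilin (ContinuousLinearMap.compL ℂ U V W) hg

/-- From `f(s)⁻¹ - f(t)⁻¹ = f(s)⁻¹ (f(t) - f(s)) f(t)⁻¹`, with inverses bounded on compact segments
because inversion is continuous. -/
theorem inverse [CompleteSpace U] {I : Set ℝ} (hI : I.OrdConnected) {f : ℝ → U →L[ℂ] V}
    (hf : LocallyAC f I) (hinv : ∀ t ∈ I, (f t).IsInvertible) :
    LocallyAC (fun t => (f t).inverse) I := by
  refine hf.of_dist_le hf fun a ha b hb => ?_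
  have hsub := hI.uIcc_subset ha hb
  have hcont : ContinuousOn (fun t => (f t).inverse) (Set.uIcc a b) := fun t ht =>
    ((hinv t (hsub ht)).contDiffAt_map_inverse (n := 0)).continuousAt.comp_continuousWithinAt
      (hf.continuousOn_uIcc ha hb t ht)
  obtain ⟨M, hM⟩ := isCompact_uIcc.exists_bound_of_continuousOn hcont
  have hM0 : 0 ≤ M := (norm_nonneg _).trans (hM a Set.left_mem_uIcc)
  refine ⟨M * M, fun s hs t ht => ?_⟩
  have key : (f s).inverse - (f t).inverse = (f s).inverse ∘L (f t - f s) ∘L (f t).inverse := by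
    ext v
    simp [(hinv t (hsub ht)).self_apply_inverse, (hinv s (hsub hs)).inverse_apply_self]
  rw [dist_eq_norm, dist_eq_norm, key, ← norm_neg (f s - f t), neg_sub]
  calc ‖(f s).inverse ∘L (f t - f s) ∘L (f t).inverse‖
      ≤ ‖(f s).inverse‖ * (‖f t - f s‖ * ‖(f t).inverse‖) :=
        (ContinuousLinearMap.opNorm_comp_le _ _).trans
          (mul_le_mul_of_nonneg_left (ContinuousLinearMap.opNorm_comp_le _ _) (norm_nonneg _))
    _ ≤ M * (‖f t - f s‖ * M) := by
        gcongr
        · exact hM s hs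
        · exact hM t ht
    _ ≤ _ := by nlinarith [norm_nonneg (f t - f s), mul_nonneg hM0 hM0]

end Comp

end LocallyAC

/-! ### Functions integrable on compact segments of an interval -/

/-- `f` is integrable on every segment with endpoints in `I`. -/
def SegmentIntegrable {V : Type*} [NormedAddCommGroup V] (f : ℝ → V) (I : Set ℝ) : Prop :=
  ∀ a ∈ I, ∀ b ∈ I, IntervalIntegrable f volume a b

namespace SegmentIntegrable

variable {V W G : Type*} [NormedAddCommGroup V] [NormedAddCommGroup W] [NormedAddCommGroup G]

theorem of_locallyIntegrableOn {I : Set ℝ} (hI : I.OrdConnected) {f : ℝ → V}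
    (hf : LocallyIntegrableOn f I volume) : SegmentIntegrable f I := fun _ ha _ hb =>
  (hf.integrableOn_compact_subset (hI.uIcc_subset ha hb) isCompact_uIcc).intervalIntegrable

theorem add {I : Set ℝ} {f g : ℝ → V} (hf : SegmentIntegrable f I) (hg : SegmentIntegrable g I) :
    SegmentIntegrable (fun t => f t + g t) I :=
  fun a ha b hb => (hf a ha b hb).add (hg a ha b hb)

theorem norm {I : Set ℝ} {f : ℝ → V} (hf : SegmentIntegrable f I) :
    SegmentIntegrable (fun t => ‖f t‖) I :=
  fun a ha b hb => (hf a ha b hb).norm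

variable [NormedSpace ℂ V] [NormedSpace ℂ W] [NormedSpace ℂ G]

theorem const_smul (c : ℂ) {I : Set ℝ} {f : ℝ → V} (hf : SegmentIntegrable f I) :
    SegmentIntegrable (fun t => c • f t) I :=
  fun a ha b hb => (hf a ha b hb).smul c

theorem clm (T : V →L[ℂ] W) {I : Set ℝ} {f : ℝ → V} (hf : SegmentIntegrable f I) :
    SegmentIntegrable (fun t => T (f t)) I := fun a ha b hb =>
  ⟨T.integrable_comp (hf a ha b hb).1, T.integrable_comp (hf a ha b hb).2⟩

theorem _root_.IntervalIntegrable.bilin_continuousOn (T : V →L[ℂ] W →L[ℂ] G) {a b : ℝ}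
    {f : ℝ → V} {g : ℝ → W} (hf : IntervalIntegrable f volume a b)
    (hg : ContinuousOn g (Set.uIcc a b)) :
    IntervalIntegrable (fun t => T (f t) (g t)) volume a b := by
  obtain ⟨M, hM⟩ := isCompact_uIcc.exists_bound_of_continuousOn hg
  have hgm : AEStronglyMeasurable g (volume.restrict (Set.uIoc a b)) :=
    (hg.mono Set.uIoc_subset_uIcc).aestronglyMeasurable measurableSet_uIoc
  refine ((hf.norm.const_mul ‖T‖).mul_const M).mono_fun
    (T.aestronglyMeasurable_comp₂ hf.def'.aestronglyMeasurable hgm) ?_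
  filter_upwards [ae_restrict_mem measurableSet_uIoc] with t ht
  refine (T.le_opNorm₂ _ _).trans ?_
  have := hM t (Set.uIoc_subset_uIcc ht)
  rw [Real.norm_eq_abs]
  exact (mul_le_mul_of_nonneg_left this (by positivity)).trans (le_abs_self _)

theorem bilin_locallyAC (T : V →L[ℂ] W →L[ℂ] G) {I : Set ℝ} {f : ℝ → V} {g : ℝ → W}
    (hf : SegmentIntegrable f I) (hg : LocallyAC g I) :
    SegmentIntegrable (fun t => T (f t) (g t)) I := fun a ha b hb =>
  (hf a ha b hb).bilin_continuousOn T (hg.continuousOn_uIcc ha hb)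

end SegmentIntegrable

theorem SegmentIntegrable.comp_locallyAC {U V W : Type*} [NormedAddCommGroup U] [NormedSpace ℂ U]
    [NormedAddCommGroup V] [NormedSpace ℂ V] [NormedAddCommGroup W] [NormedSpace ℂ W]
    {I : Set ℝ} {f : ℝ → V →L[ℂ] W} {g : ℝ → U →L[ℂ] V}
    (hf : SegmentIntegrable f I) (hg : LocallyAC g I) : SegmentIntegrable (fun t => f t ∘L g t) I :=
  hf.bilin_locallyAC (ContinuousLinearMap.compL ℂ U V W) hg

theorem LocallyAC.comp_segmentIntegrable {U V W : Type*} [NormedAddCommGroup U] [NormedSpace ℂ U]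
    [NormedAddCommGroup V] [NormedSpace ℂ V] [NormedAddCommGroup W] [NormedSpace ℂ W]
    {I : Set ℝ} {f : ℝ → V →L[ℂ] W} {g : ℝ → U →L[ℂ] V}
    (hf : LocallyAC f I) (hg : SegmentIntegrable g I) : SegmentIntegrable (fun t => f t ∘L g t) I :=
  hg.bilin_locallyAC (ContinuousLinearMap.compL ℂ U V W).flip hf

/-! ### Absolutely continuous functions with a given almost everywhere derivative -/

/-- `F` is locally absolutely continuous on `I` and has derivative `f` almost everywhere on `I`. -/
structure HasACDeriv {V : Type*} [NormedAddCommGroup V] [NormedSpace ℝ V] (F f : ℝ → V)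
    (I : Set ℝ) : Prop where
  locallyAC : LocallyAC F I
  hasDerivAt : ∀ᵐ t ∂(volume.restrict I), HasDerivAt F (f t) t

/-- Only endpoints are lost. This is needed because derivatives are two-sided, while functions are
controlled only on `I`. -/
theorem Set.OrdConnected.ae_mem_interior {I : Set ℝ} (hI : I.OrdConnected) :
    ∀ᵐ t ∂(volume.restrict I), t ∈ interior I := by
  rw [ae_restrict_iff' hI.measurableSet]
  refine ae_of_mem_of_ae_of_mem_inter_Ioo fun a b ha hb _ => Eventually.of_forall fun t ht => ?_
  exact mem_interior_iff_mem_nhds.2 (mem_of_superset (Ioo_mem_nhds ht.2.1 ht.2.2)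
    (Set.Ioo_subset_Icc_self.trans (hI.out ha hb)))

namespace HasACDeriv

section Real

variable {V : Type*} [NormedAddCommGroup V] [NormedSpace ℝ V] {I : Set ℝ}

theorem const (I : Set ℝ) (c : V) : HasACDeriv (fun _ => c) (fun _ => 0) I :=
  ⟨.const I c, Eventually.of_forall fun t => hasDerivAt_const t c⟩

theorem add {F G f g : ℝ → V} (hF : HasACDeriv F f I) (hG : HasACDeriv G g I) :
    HasACDeriv (fun t => F t + G t) (fun t => f t + g t) I :=
  ⟨hF.locallyAC.add hG.locallyAC, by
    filter_upwards [hF.hasDerivAt, hG.hasDerivAt] with t h₁ h₂ using h₁.add h₂⟩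

theorem sub {F G f g : ℝ → V} (hF : HasACDeriv F f I) (hG : HasACDeriv G g I) :
    HasACDeriv (fun t => F t - G t) (fun t => f t - g t) I :=
  ⟨hF.locallyAC.sub hG.locallyAC, by
    filter_upwards [hF.hasDerivAt, hG.hasDerivAt] with t h₁ h₂ using h₁.sub h₂⟩

theorem congr_deriv {F f g : ℝ → V} (hI : I.OrdConnected) (hF : HasACDeriv F f I)
    (h : ∀ t ∈ I, f t = g t) : HasACDeriv F g I :=
  ⟨hF.locallyAC, by
    filter_upwards [hF.hasDerivAt, ae_restrict_mem hI.measurableSet] with t h₁ h₂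
    exact h t h₂ ▸ h₁⟩

theorem congr {F G f : ℝ → V} (hI : I.OrdConnected) (hF : HasACDeriv F f I)
    (h : ∀ t ∈ I, G t = F t) : HasACDeriv G f I :=
  ⟨hF.locallyAC.congr hI h, by
    filter_upwards [hF.hasDerivAt, hI.ae_mem_interior] with t h₁ h₂
    exact h₁.congr_of_eventuallyEq
      (eventually_of_mem (mem_interior_iff_mem_nhds.1 h₂) fun s hs => h s hs)⟩

/-- The source of all conservation laws below, including invertibility and uniqueness for the ODEs.
-/
theorem eq_of_deriv_eq_zero (hI : I.OrdConnected) {F f : ℝ → V} (hF : HasACDeriv F f I)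
    (hf : ∀ t ∈ I, f t = 0) {a b : ℝ} (ha : a ∈ I) (hb : b ∈ I) : F b = F a := by
  have hae : ∀ᵐ t, t ∈ Set.uIcc a b → HasDerivAt F 0 t := by
    filter_upwards [(ae_restrict_iff' hI.measurableSet).1 hF.hasDerivAt] with t ht hts
    have htI := hI.uIcc_subset ha hb hts
    exact hf t htI ▸ ht htI
  obtain ⟨C, hC⟩ := (hF.locallyAC a ha b hb).const_of_ae_hasDerivAt_zero hae
  rw [hC a Set.left_mem_uIcc, hC b Set.right_mem_uIcc]

theorem integral [CompleteSpace V] (hI : I.OrdConnected) {f : ℝ → V} (hf : SegmentIntegrable f I)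
    {c : ℝ} (hc : c ∈ I) : HasACDeriv (fun t => ∫ s in c..t, f s) f I := by
  constructor
  -- Increments of the primitive of `f` are bounded by those of the primitive of `‖f‖`, so the
  -- real-valued case suffices.
  · have hn : LocallyAC (fun t => ∫ s in c..t, ‖f s‖) I := by
      intro a ha b hb
      -- The segment is enlarged to contain the base point `c`, and the result is restricted
      -- afterwards.
      have hmin : min c (min a b) ∈ I := by
        rcases min_choice c (min a b) with h | h <;> rcases min_choice a b with h' | h' <;>
          simp_all
      have hmax : max c (max a b) ∈ I := by
        rcases max_choice c (max a b) with h | h <;> rcases max_choice a b with h' | h' <;>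
          simp_all
      have hle : min c (min a b) ≤ max c (max a b) := (min_le_left _ _).trans (le_max_left _ _)
      refine ((hf.norm _ hmin _ hmax).absolutelyContinuousOnInterval_intervalIntegral
        (c := c) ?_).mono ?_
      · rw [Set.uIcc_of_le hle]
        exact ⟨min_le_left _ _, le_max_left _ _⟩
      · rw [Set.uIcc_of_le hle, Set.uIcc]
        exact Set.Icc_subset_Icc (min_le_right _ _) (le_max_right _ _)
    refine hn.of_dist_le hn fun a ha b hb => ⟨1, fun s hs t ht => ?_⟩
    have hs' := hI.uIcc_subset ha hb hs
    have ht' := hI.uIcc_subset ha hb ht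
    rw [one_mul, dist_eq_norm, dist_eq_norm,
      intervalIntegral.integral_interval_sub_left (hf c hc s hs') (hf c hc t ht'),
      intervalIntegral.integral_interval_sub_left (hf.norm c hc s hs') (hf.norm c hc t ht')]
    exact (intervalIntegral.norm_integral_le_abs_integral_norm).trans
      (le_add_of_nonneg_left (norm_nonneg _))
  · rw [ae_restrict_iff' hI.measurableSet]
    refine ae_of_mem_of_ae_of_mem_inter_Ioo fun a b ha hb hab => ?_
    filter_upwards [(hf a ha b hb).ae_hasDerivAt_integral] with t ht hts
    have htu : t ∈ Set.uIcc a b := by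
      rw [Set.uIcc_of_lt hab]; exact Set.Ioo_subset_Icc_self hts.2
    have h := (ht htu a Set.left_mem_uIcc).const_add (∫ s in c..a, f s)
    refine h.congr_of_eventuallyEq ?_
    filter_upwards [Ioo_mem_nhds hts.2.1 hts.2.2] with s hs
    have hsI := hI.out ha hb (Set.Ioo_subset_Icc_self hs)
    exact (intervalIntegral.integral_add_adjacent_intervals (hf c hc a ha) (hf a ha s hsI)).symm

theorem integral_eq_sub [CompleteSpace V] (hI : I.OrdConnected) {F f : ℝ → V}
    (hF : HasACDeriv F f I) (hf : SegmentIntegrable f I) {a b : ℝ} (ha : a ∈ I) (hb : b ∈ I) :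
    ∫ s in a..b, f s = F b - F a := by
  have h := (hF.sub (integral hI hf ha)).eq_of_deriv_eq_zero hI (fun t _ => sub_self _) ha hb
  simp only [intervalIntegral.integral_same, sub_zero] at h
  rw [← h]; abel

end Real

section Complex

variable {V W G : Type*} [NormedAddCommGroup V] [NormedSpace ℂ V] [NormedAddCommGroup W]
  [NormedSpace ℂ W] [NormedAddCommGroup G] [NormedSpace ℂ G] {I : Set ℝ}

theorem bilin (T : V →L[ℂ] W →L[ℂ] G) {f f' : ℝ → V} {g g' : ℝ → W}
    (hf : HasACDeriv f f' I) (hg : HasACDeriv g g' I) :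
    HasACDeriv (fun t => T (f t) (g t)) (fun t => T (f t) (g' t) + T (f' t) (g t)) I :=
  ⟨hf.locallyAC.bilin T hg.locallyAC, by
    filter_upwards [hf.hasDerivAt, hg.hasDerivAt] with t h₁ h₂
    exact (ContinuousLinearMap.hasDerivAt_of_bilinear (B := T.bilinearRestrictScalars ℝ)
      (fun _ => h₁) (fun _ => h₂))⟩

end Complex

section Comp

variable {U V W : Type*} [NormedAddCommGroup U] [NormedSpace ℂ U] [NormedAddCommGroup V]
  [NormedSpace ℂ V] [NormedAddCommGroup W] [NormedSpace ℂ W] {I : Set ℝ}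

theorem comp {f f' : ℝ → V →L[ℂ] W} {g g' : ℝ → U →L[ℂ] V}
    (hf : HasACDeriv f f' I) (hg : HasACDeriv g g' I) :
    HasACDeriv (fun t => f t ∘L g t) (fun t => f t ∘L g' t + f' t ∘L g t) I :=
  hf.bilin (ContinuousLinearMap.compL ℂ U V W) hg

theorem apply {f f' : ℝ → V →L[ℂ] W} {g g' : ℝ → V}
    (hf : HasACDeriv f f' I) (hg : HasACDeriv g g' I) :
    HasACDeriv (fun t => f t (g t)) (fun t => f t (g' t) + f' t (g t)) I :=
  hf.bilin (ContinuousLinearMap.id ℂ (V →L[ℂ] W)) hg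

theorem comp_const {f f' : ℝ → V →L[ℂ] W} (hf : HasACDeriv f f' I) (T : U →L[ℂ] V) :
    HasACDeriv (fun t => f t ∘L T) (fun t => f' t ∘L T) I := by
  simpa using hf.comp (const I T)

theorem const_comp {g g' : ℝ → U →L[ℂ] V} (T : V →L[ℂ] W) (hg : HasACDeriv g g' I) :
    HasACDeriv (fun t => T ∘L g t) (fun t => T ∘L g' t) I := by
  simpa using (const I T).comp hg

theorem apply_const {f f' : ℝ → V →L[ℂ] W} (hf : HasACDeriv f f' I) (v : V) :
    HasACDeriv (fun t => f t v) (fun t => f' t v) I := by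
  simpa using hf.apply (const I v)

end Comp

end HasACDeriv

/-! ### Holomorphic dependence of integrals on a parameter -/

/-- A family `X z s`, entire in `z` and continuous in `s` on the segment from `a` to `b`, bounded on
that segment uniformly for `z` in bounded sets. -/
structure EntireFamilyOn {V : Type*} [NormedAddCommGroup V] [NormedSpace ℂ V]
    (X : ℂ → ℝ → V) (a b : ℝ) : Prop where
  continuousOn : ∀ z, ContinuousOn (X z) (Set.uIcc a b)
  differentiable : ∀ s ∈ Set.uIcc a b, Differentiable ℂ (fun z => X z s)
  bounded : ∀ R : ℝ, ∃ M : ℝ, ∀ z : ℂ, ‖z‖ ≤ R → ∀ s ∈ Set.uIcc a b, ‖X z s‖ ≤ M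

/-- Differentiation under the integral sign: Cauchy's estimate on unit circles turns the uniform
bound on `X` into one on its `z`-derivative, so a multiple of `‖g‖` dominates. -/
theorem EntireFamilyOn.differentiable_integral {V W : Type*} [NormedAddCommGroup V]
    [NormedSpace ℂ V] [NormedAddCommGroup W] [NormedSpace ℂ W] [CompleteSpace W]
    {X : ℂ → ℝ → V} {a b : ℝ} (hX : EntireFamilyOn X a b) {g : ℝ → V →L[ℂ] W}
    (hg : IntervalIntegrable g volume a b) :
    Differentiable ℂ (fun z => ∫ s in a..b, g s (X z s)) := by
  intro z₀
  -- One unit for the ball of parameters around `z₀`, one for the Cauchy circles around its points.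
  obtain ⟨M, hM⟩ := hX.bounded (‖z₀‖ + 2)
  have hint : ∀ z, IntervalIntegrable (fun s => g s (X z s)) volume a b := fun z =>
    hg.bilin_continuousOn (ContinuousLinearMap.id ℂ (V →L[ℂ] W)) (hX.continuousOn z)
  have hgm := hg.def'.aestronglyMeasurable
  have hXm : ∀ z, AEStronglyMeasurable (X z) (volume.restrict (Set.uIoc a b)) := fun z =>
    ((hX.continuousOn z).mono Set.uIoc_subset_uIcc).aestronglyMeasurable measurableSet_uIoc
  -- The derivative is measurable in `s` as a pointwise limit of difference quotients along a
  -- sequence.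
  have hdm : AEStronglyMeasurable (fun s => deriv (fun z => X z s) z₀)
      (volume.restrict (Set.uIoc a b)) := by
    let w : ℕ → ℂ := fun n => ((n : ℂ) + 1)⁻¹
    have hw : Tendsto w atTop (𝓝[≠] 0) := by
      refine tendsto_nhdsWithin_iff.2 ⟨?_, Eventually.of_forall fun n => ?_⟩
      · simpa [w, one_div] using (tendsto_one_div_add_atTop_nhds_zero_nat (𝕜 := ℂ))
      · exact inv_ne_zero (Nat.cast_add_one_ne_zero n)
    refine aestronglyMeasurable_of_tendsto_ae atTop
      (f := fun n s => (w n)⁻¹ • (X (z₀ + w n) s - X z₀ s))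
      (fun n => ((hXm _).sub (hXm _)).const_smul _) ?_
    filter_upwards [ae_restrict_mem measurableSet_uIoc] with s hs
    exact (hasDerivAt_iff_tendsto_slope_zero.1
      (hX.differentiable s (Set.uIoc_subset_uIcc hs) z₀).hasDerivAt).comp hw
  refine (intervalIntegral.hasDerivAt_integral_of_dominated_loc_of_deriv_le
    (F' := fun z s => g s (deriv (fun z => X z s) z)) (bound := fun s => ‖g s‖ * M)
    (Metric.ball_mem_nhds z₀ one_pos) (Eventually.of_forall fun z =>
      (hint z).def'.aestronglyMeasurable) (hint z₀)
    ((ContinuousLinearMap.id ℂ (V →L[ℂ] W)).aestronglyMeasurable_comp₂ hgm hdm)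
    ?_ (hg.norm.mul_const M) ?_).2.differentiableAt
  · refine Eventually.of_forall fun s hs z hz => ?_
    refine ((g s).le_opNorm _).trans (mul_le_mul_of_nonneg_left ?_ (norm_nonneg _))
    have h := Complex.norm_deriv_le_of_forall_mem_sphere_norm_le (c := z) (R := 1) (C := M) one_pos
      (hX.differentiable s (Set.uIoc_subset_uIcc hs)).diffContOnCl (fun y hy =>
        hM y ?_ s (Set.uIoc_subset_uIcc hs))
    · simpa using h
    · have h₁ : ‖y - z‖ = 1 := by simpa using hy
      have h₂ : ‖z - z₀‖ < 1 := by simpa [dist_eq_norm] using hz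
      calc ‖y‖ = ‖(y - z) + (z - z₀) + z₀‖ := by congr 1; ring
        _ ≤ ‖y - z‖ + ‖z - z₀‖ + ‖z₀‖ := norm_add₃_le
        _ ≤ _ := by linarith
  · exact Eventually.of_forall fun s hs z _ =>
      ((g s).hasFDerivAt.comp_hasDerivAt z
        (hX.differentiable s (Set.uIoc_subset_uIcc hs) z).hasDerivAt)

/-! ### Linear differential equations with integrable coefficients -/

/-- Without absolute values the integrand is the derivative of `h ^ (n + 1) / (n + 1)`, `h` being
the primitive of `k`. As `k ≥ 0`, `h` has constant sign on each side of `c`. This produces the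
factorials in the Picard bound, in both directions of time. -/
theorem integral_mul_abs_integral_pow {I : Set ℝ} (hI : I.OrdConnected) {k : ℝ → ℝ}
    (hk : SegmentIntegrable k I) (hk0 : ∀ t, 0 ≤ k t) {c t : ℝ} (hc : c ∈ I) (ht : t ∈ I) (n : ℕ) :
    |∫ s in c..t, k s * |∫ r in c..s, k r| ^ n| = |∫ s in c..t, k s| ^ (n + 1) / (n + 1) := by
  set h : ℝ → ℝ := fun s => ∫ r in c..s, k r with hh
  have hP : HasACDeriv h k I := HasACDeriv.integral hI hk hc
  have hpow : ∀ m : ℕ, LocallyAC (fun s => h s ^ m) I := by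
    intro m
    induction m with
    | zero => simpa using LocallyAC.const I (1 : ℝ)
    | succ m ih =>
      intro a ha b hb
      simpa [pow_succ] using (ih a ha b hb).fun_mul (hP.locallyAC a ha b hb)
  have hD : HasACDeriv (fun s => h s ^ (n + 1)) (fun s => ((n : ℝ) + 1) * (k s * h s ^ n)) I := by
    refine ⟨hpow _, ?_⟩
    filter_upwards [hP.hasDerivAt] with s hs
    have h₁ := hs.fun_pow (n + 1)
    rw [add_tsub_cancel_right] at h₁
    exact h₁.congr_deriv (by push_cast; ring)
  have hint : SegmentIntegrable (fun s => k s * h s ^ n) I := fun a ha b hb =>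
    (hk a ha b hb).mul_continuousOn ((hpow n).continuousOn_uIcc ha hb)
  have hval : ∫ s in c..t, k s * h s ^ n = h t ^ (n + 1) / (n + 1) := by
    have := hD.integral_eq_sub hI (fun a ha b hb => (hint a ha b hb).const_mul _) hc ht
    rw [intervalIntegral.integral_const_mul] at this
    rw [eq_div_iff (by positivity), mul_comm, this]
    simp [hh]
  have hn : (0 : ℝ) < n + 1 := by positivity
  rcases le_total c t with hct | hct
  · have : ∫ s in c..t, k s * |h s| ^ n = ∫ s in c..t, k s * h s ^ n := by
      refine intervalIntegral.integral_congr fun s hs => ?_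
      rw [Set.uIcc_of_le hct] at hs
      simp only [abs_of_nonneg (show 0 ≤ h s from
        intervalIntegral.integral_nonneg hs.1 fun r _ => hk0 r)]
    rw [this, hval, abs_div, abs_pow, abs_of_pos hn]
  · have : ∫ s in c..t, k s * |h s| ^ n = (-1) ^ n * ∫ s in c..t, k s * h s ^ n := by
      rw [← intervalIntegral.integral_const_mul]
      refine intervalIntegral.integral_congr fun s hs => ?_
      rw [Set.uIcc_of_ge hct] at hs
      have h0 : h s ≤ 0 := by
        rw [hh]; simp only
        rw [intervalIntegral.integral_symm]
        exact neg_nonpos.2 (intervalIntegral.integral_nonneg hs.2 fun r _ => hk0 r)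
      simp only [abs_of_nonpos h0, neg_pow (h s) n]; ring
    rw [this, hval, abs_mul, abs_div, abs_pow, abs_of_pos hn]
    simp [hh]

section LinearODE

variable {V : Type*} [NormedAddCommGroup V] [NormedSpace ℂ V]

/-- The Picard iterates (Peano-Baker terms) of `x' = (L₀ + z L₁) x`, `x(c) = x₀`. -/
noncomputable def picardTerm (L₀ L₁ : ℝ → V →L[ℂ] V) (c : ℝ) (x₀ : V) : ℕ → ℂ → ℝ → V
  | 0, _, _ => x₀
  | n + 1, z, t => ∫ s in c..t, (L₀ s + z • L₁ s) (picardTerm L₀ L₁ c x₀ n z s)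

variable {I : Set ℝ} (hI : I.OrdConnected) {L₀ L₁ : ℝ → V →L[ℂ] V}
  (h₀ : SegmentIntegrable L₀ I) (h₁ : SegmentIntegrable L₁ I) {c : ℝ} (hc : c ∈ I) (x₀ : V)

include hI h₀ h₁ hc

/-- Induction with the majorant `‖L₀‖ + R ‖L₁‖`, which serves all `‖z‖ ≤ R` at once; this uniformity
later makes the sum of the series holomorphic. -/
theorem norm_picardTerm_le (n : ℕ) {z : ℂ} {R : ℝ} (hz : ‖z‖ ≤ R) {t : ℝ} (ht : t ∈ I) :
    ‖picardTerm L₀ L₁ c x₀ n z t‖ ≤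
      ‖x₀‖ * (|∫ s in c..t, (‖L₀ s‖ + R * ‖L₁ s‖)| ^ n / n.factorial) := by
  have hR : 0 ≤ R := (norm_nonneg z).trans hz
  set k : ℝ → ℝ := fun s => ‖L₀ s‖ + R * ‖L₁ s‖ with hkdef
  have hk : SegmentIntegrable k I := fun a ha b hb =>
    (h₀ a ha b hb).norm.add ((h₁ a ha b hb).norm.const_mul R)
  have hk0 : ∀ s, 0 ≤ k s := fun s => by positivity
  induction n generalizing t with
  | zero => simp [picardTerm]
  | succ n ih =>
    have hcont : ContinuousOn (fun s => |∫ r in c..s, k r| ^ n) (Set.uIcc c t) :=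
      (((HasACDeriv.integral hI hk hc).locallyAC.continuousOn_uIcc hc ht).abs).pow n
    have hint : IntervalIntegrable (fun s => (‖x₀‖ / n.factorial) *
        (k s * |∫ r in c..s, k r| ^ n)) volume c t :=
      ((hk c hc t ht).mul_continuousOn hcont).const_mul _
    calc ‖picardTerm L₀ L₁ c x₀ (n + 1) z t‖
        ≤ |∫ s in c..t, (‖x₀‖ / n.factorial) * (k s * |∫ r in c..s, k r| ^ n)| := by
          refine intervalIntegral.norm_integral_le_abs_of_norm_le ?_ hint
          filter_upwards [ae_restrict_mem measurableSet_uIoc] with s hs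
          have hsI := hI.uIcc_subset hc ht (Set.uIoc_subset_uIcc hs)
          calc ‖(L₀ s + z • L₁ s) (picardTerm L₀ L₁ c x₀ n z s)‖
              ≤ ‖L₀ s + z • L₁ s‖ * ‖picardTerm L₀ L₁ c x₀ n z s‖ :=
                ContinuousLinearMap.le_opNorm _ _
            _ ≤ k s * (‖x₀‖ * (|∫ r in c..s, k r| ^ n / n.factorial)) := by
                refine mul_le_mul ((norm_add_le _ _).trans ?_) (ih hsI) (norm_nonneg _) (hk0 s)
                rw [norm_smul]
                exact add_le_add_right (mul_le_mul_of_nonneg_right hz (norm_nonneg _)) _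
            _ = _ := by ring
      _ = (‖x₀‖ / n.factorial) * (|∫ s in c..t, k s| ^ (n + 1) / (n + 1)) := by
          rw [intervalIntegral.integral_const_mul, abs_mul,
            integral_mul_abs_integral_pow hI hk hk0 hc ht, abs_of_nonneg (by positivity)]
      _ = _ := by
          rw [Nat.factorial_succ]; push_cast; field_simp

theorem exists_uniform_norm_picardTerm_le (R : ℝ) {t : ℝ} (ht : t ∈ I) :
    ∃ m : ℝ, 0 ≤ m ∧ ∀ n, ∀ z : ℂ, ‖z‖ ≤ R → ∀ s ∈ Set.uIcc c t,
      ‖picardTerm L₀ L₁ c x₀ n z s‖ ≤ ‖x₀‖ * (m ^ n / n.factorial) := by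
  have hk : SegmentIntegrable (fun s => ‖L₀ s‖ + R * ‖L₁ s‖) I := fun a ha b hb =>
    (h₀ a ha b hb).norm.add ((h₁ a ha b hb).norm.const_mul R)
  obtain ⟨m, hm0, hm⟩ := (HasACDeriv.integral hI hk hc).locallyAC.exists_bound hc ht
  refine ⟨m, hm0, fun n z hz s hs => (norm_picardTerm_le hI h₀ h₁ hc x₀ n hz
    (hI.uIcc_subset hc ht hs)).trans ?_⟩
  have := hm s hs
  rw [Real.norm_eq_abs] at this
  gcongr

variable [CompleteSpace V]

theorem picardTerm_locallyAC (n : ℕ) (z : ℂ) : LocallyAC (picardTerm L₀ L₁ c x₀ n z) I := by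
  induction n with
  | zero => exact LocallyAC.const I x₀
  | succ n ih =>
    exact (HasACDeriv.integral hI ((h₀.add (h₁.const_smul z)).bilin_locallyAC
      (ContinuousLinearMap.id ℂ (V →L[ℂ] V)) ih) hc).locallyAC

/-- Each iterate splits into an `L₀` integral plus `z` times an `L₁` integral, so holomorphy
propagates by differentiation under the integral. -/
theorem picardTerm_entireFamilyOn (n : ℕ) {t : ℝ} (ht : t ∈ I) :
    EntireFamilyOn (picardTerm L₀ L₁ c x₀ n) c t := by
  induction n generalizing t with
  | zero => exact ⟨fun _ => continuousOn_const, fun _ _ => differentiable_const _,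
      fun _ => ⟨‖x₀‖, fun _ _ _ _ => le_rfl⟩⟩
  | succ n ih =>
    refine ⟨fun z => (picardTerm_locallyAC hI h₀ h₁ hc x₀ _ z).continuousOn_uIcc hc ht,
      fun s hs => ?_, fun R => ?_⟩
    · have hsI := hI.uIcc_subset hc ht hs
      have hX := ih hsI
      have heq : (fun z => picardTerm L₀ L₁ c x₀ (n + 1) z s) = fun z =>
          (∫ r in c..s, L₀ r (picardTerm L₀ L₁ c x₀ n z r)) +
            z • ∫ r in c..s, L₁ r (picardTerm L₀ L₁ c x₀ n z r) := by
        funext z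
        have i₀ := (h₀ c hc s hsI).bilin_continuousOn (ContinuousLinearMap.id ℂ (V →L[ℂ] V))
          (hX.continuousOn z)
        have i₁ := (h₁ c hc s hsI).bilin_continuousOn (ContinuousLinearMap.id ℂ (V →L[ℂ] V))
          (hX.continuousOn z)
        rw [← intervalIntegral.integral_smul]
        exact intervalIntegral.integral_add i₀ (i₁.smul z)
      rw [heq]
      exact (hX.differentiable_integral (h₀ c hc s hsI)).add
        (differentiable_id.smul (hX.differentiable_integral (h₁ c hc s hsI)))
    · obtain ⟨m, -, hm⟩ := exists_uniform_norm_picardTerm_le hI h₀ h₁ hc x₀ R ht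
      exact ⟨_, fun z hz s hs => hm (n + 1) z hz s hs⟩

/-- Solvability of `x' = (L₀ + z L₁) x`, `x(c) = x₀` on an interval, with entire dependence on the
parameter `z`. -/
theorem exists_entire_linear_solution :
    ∃ X : ℂ → ℝ → V, (∀ z, X z c = x₀) ∧
      (∀ z, HasACDeriv (X z) (fun t => L₀ t (X z t) + z • L₁ t (X z t)) I) ∧
      ∀ t ∈ I, EntireFamilyOn X c t := by
  set T := picardTerm L₀ L₁ c x₀ with hT
  let X : ℂ → ℝ → V := fun z t => ∑' n, T n z t
  have hsum : ∀ m : ℝ, Summable fun n : ℕ => ‖x₀‖ * (m ^ n / n.factorial) := fun m =>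
    (Real.summable_pow_div_factorial m).mul_left _
  have hHas : ∀ z, ∀ t ∈ I, HasSum (fun n => T n z t) (X z t) := fun z t ht => by
    obtain ⟨m, -, hm⟩ := exists_uniform_norm_picardTerm_le hI h₀ h₁ hc x₀ ‖z‖ ht
    exact (Summable.of_norm_bounded (hsum m)
      fun n => hm n z le_rfl t Set.right_mem_uIcc).hasSum
  have hcont : ∀ z, ∀ t ∈ I, ContinuousOn (X z) (Set.uIcc c t) := fun z t ht => by
    obtain ⟨m, -, hm⟩ := exists_uniform_norm_picardTerm_le hI h₀ h₁ hc x₀ ‖z‖ ht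
    exact continuousOn_tsum
      (fun n => (picardTerm_locallyAC hI h₀ h₁ hc x₀ n z).continuousOn_uIcc hc ht) (hsum m)
      fun n s hs => hm n z le_rfl s hs
  have hinteg : ∀ z, ∀ t ∈ I,
      IntervalIntegrable (fun s => (L₀ s + z • L₁ s) (X z s)) volume c t := fun z t ht =>
    (h₀.add (h₁.const_smul z) c hc t ht).bilin_continuousOn
      (ContinuousLinearMap.id ℂ (V →L[ℂ] V)) (hcont z t ht)
  -- The Volterra equation, by termwise integration of the series under an exponential majorant.
  have hfix : ∀ z, ∀ t ∈ I, X z t = x₀ + ∫ s in c..t, (L₀ s + z • L₁ s) (X z s) := by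
    intro z t ht
    obtain ⟨m, -, hm⟩ := exists_uniform_norm_picardTerm_le hI h₀ h₁ hc x₀ ‖z‖ ht
    have hL := h₀.add (h₁.const_smul z) c hc t ht
    have h := intervalIntegral.hasSum_integral_of_dominated_convergence
      (F := fun n s => (L₀ s + z • L₁ s) (T n z s)) (f := fun s => (L₀ s + z • L₁ s) (X z s))
      (μ := volume) (a := c) (b := t)
      (fun n s => ‖L₀ s + z • L₁ s‖ * (‖x₀‖ * (m ^ n / n.factorial)))
      (fun n => (hL.bilin_continuousOn (ContinuousLinearMap.id ℂ (V →L[ℂ] V))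
        ((picardTerm_locallyAC hI h₀ h₁ hc x₀ n z).continuousOn_uIcc hc ht)).def'.1)
      (fun n => Eventually.of_forall fun s hs => ((L₀ s + z • L₁ s).le_opNorm _).trans
        (mul_le_mul_of_nonneg_left (hm n z le_rfl s (Set.uIoc_subset_uIcc hs)) (norm_nonneg _)))
      (Eventually.of_forall fun s _ => (hsum m).mul_left _)
      (by simpa only [tsum_mul_left] using hL.norm.mul_const _)
      (Eventually.of_forall fun s hs => (hHas z s
        (hI.uIcc_subset hc ht (Set.uIoc_subset_uIcc hs))).mapL (L₀ s + z • L₁ s))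
    -- Integrating term `n` gives term `n + 1`, so the series is compared with its tail after the
    -- initial value.
    have h' := (hasSum_nat_add_iff' (f := fun n => T n z t) 1).2 (hHas z t ht)
    rw [Finset.sum_range_one] at h'
    rw [← h'.unique h]
    simp [hT, picardTerm]
  refine ⟨X, fun z => ?_, fun z => ?_, fun t ht => ⟨fun z => hcont z t ht, fun s hs => ?_,
    fun R => ?_⟩⟩
  · rw [hfix z c hc]; simp
  · have hseg : SegmentIntegrable (fun s => (L₀ s + z • L₁ s) (X z s)) I := fun a ha b hb =>
      (hinteg z a ha).symm.trans (hinteg z b hb)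
    have h := ((HasACDeriv.const I x₀).add (HasACDeriv.integral hI hseg hc)).congr hI
      (fun t ht => hfix z t ht)
    exact h.congr_deriv hI fun t _ => by simp
  · have hsI := hI.uIcc_subset hc ht hs
    intro z
    obtain ⟨m, -, hm⟩ := exists_uniform_norm_picardTerm_le hI h₀ h₁ hc x₀ (‖z‖ + 1) hsI
    refine (Complex.differentiableOn_tsum_of_summable_norm (F := fun n z => T n z s)
      (U := Metric.ball 0 (‖z‖ + 1)) (hsum m)
      (fun n => ((picardTerm_entireFamilyOn hI h₀ h₁ hc x₀ n hsI).differentiable s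
        Set.right_mem_uIcc).differentiableOn) Metric.isOpen_ball fun n w hw => hm n w ?_ s
        Set.right_mem_uIcc).differentiableAt (Metric.isOpen_ball.mem_nhds (by simp))
    simpa using (mem_ball_zero_iff.1 hw).le
  · obtain ⟨m, -, hm⟩ := exists_uniform_norm_picardTerm_le hI h₀ h₁ hc x₀ R ht
    exact ⟨∑' n : ℕ, ‖x₀‖ * (m ^ n / n.factorial), fun z hz s hs =>
      tsum_of_norm_bounded (hsum m).hasSum fun n => hm n z hz s hs⟩

end LinearODE

/-! ### Fundamental solutions -/

/-- `1 - P` is idempotent, so its norm is `0` or at least `1`; by connectedness it cannot leave `0`.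
This upgrades a left inverse to a two-sided one, which is not automatic in infinite dimension. -/
theorem eq_one_of_idempotent_of_continuousOn {V : Type*} [NormedRing V] {I : Set ℝ}
    (hI : I.OrdConnected) {P : ℝ → V} (hP : ContinuousOn P I) (hidem : ∀ t ∈ I, P t * P t = P t)
    {c : ℝ} (hc : c ∈ I) (hPc : P c = 1) {t : ℝ} (ht : t ∈ I) : P t = 1 := by
  by_contra hne
  have hle : ∀ s ∈ I, ‖1 - P s‖ = 0 ∨ 1 ≤ ‖1 - P s‖ := by
    intro s hs
    by_contra! h
    have h0 : 0 < ‖1 - P s‖ := lt_of_le_of_ne (norm_nonneg _) (Ne.symm h.1)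
    have hQ : (1 - P s) * (1 - P s) = 1 - P s := by
      rw [mul_sub, sub_mul, sub_mul, hidem s hs]; simp
    have := norm_mul_le (1 - P s) (1 - P s)
    rw [hQ] at this
    nlinarith [h.2]
  have hpc : IsPreconnected ((fun s => ‖1 - P s‖) '' I) :=
    hI.isPreconnected.image _ ((continuousOn_const.sub hP).norm)
  have hmem : (1 / 2 : ℝ) ∈ (fun s => ‖1 - P s‖) '' I := by
    refine hpc.ordConnected.out ⟨c, hc, rfl⟩ ⟨t, ht, rfl⟩ ⟨by simp [hPc], ?_⟩
    rcases hle t ht with h | h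
    · exact absurd (sub_eq_zero.1 (norm_eq_zero.1 h)).symm hne
    · simp only; linarith
  obtain ⟨s, hs, hs'⟩ := hmem
  simp only at hs'
  rcases hle s hs with h | h <;> linarith

theorem LocallyAC.continuousOn {V : Type*} [NormedAddCommGroup V] {I : Set ℝ}
    {f : ℝ → V} (hf : LocallyAC f I) : ContinuousOn f I := by
  intro t ht
  by_cases hl : ∃ a ∈ I, a < t
  · obtain ⟨a, ha, hat⟩ := hl
    by_cases hr : ∃ b ∈ I, t < b
    · obtain ⟨b, hb, htb⟩ := hr
      refine ((hf.continuousOn_uIcc ha hb).continuousAt ?_).continuousWithinAt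
      rw [Set.uIcc_of_lt (hat.trans htb)]
      exact Icc_mem_nhds hat htb
    · push Not at hr
      refine (hf.continuousOn_uIcc ha ht t Set.right_mem_uIcc).mono_of_mem_nhdsWithin ?_
      rw [Set.uIcc_of_lt hat]
      filter_upwards [self_mem_nhdsWithin, mem_nhdsWithin_of_mem_nhds (Ioi_mem_nhds hat)]
        with s hs hs'
      exact ⟨le_of_lt hs', hr s hs⟩
  · push Not at hl
    by_cases hr : ∃ b ∈ I, t < b
    · obtain ⟨b, hb, htb⟩ := hr
      refine (hf.continuousOn_uIcc ht hb t Set.left_mem_uIcc).mono_of_mem_nhdsWithin ?_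
      rw [Set.uIcc_of_lt htb]
      filter_upwards [self_mem_nhdsWithin, mem_nhdsWithin_of_mem_nhds (Iio_mem_nhds htb)]
        with s hs hs'
      exact ⟨hl s hs, le_of_lt hs'⟩
    · push Not at hr
      have : I ⊆ {t} := fun s hs => le_antisymm (hr s hs) (hl s hs)
      exact (continuousWithinAt_singleton).mono this

/-- `Φ z t` is the fundamental solution of `u' = (N + z K) u` normalised at `c`, and `Ψ z t` is its
inverse. -/
structure IsPropagator {X : Type*} [NormedAddCommGroup X] [NormedSpace ℂ X]
    (K N : ℝ → X →L[ℂ] X) (I : Set ℝ) (c : ℝ) (Φ Ψ : ℂ → ℝ → X →L[ℂ] X) : Prop where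
  init : ∀ z, Φ z c = 1
  init_inv : ∀ z, Ψ z c = 1
  hasACDeriv : ∀ z, HasACDeriv (Φ z) (fun t => (N t + z • K t) ∘L Φ z t) I
  hasACDeriv_inv : ∀ z, HasACDeriv (Ψ z) (fun t => -(Ψ z t ∘L (N t + z • K t))) I
  inv_comp : ∀ z, ∀ t ∈ I, Ψ z t ∘L Φ z t = 1
  comp_inv : ∀ z, ∀ t ∈ I, Φ z t ∘L Ψ z t = 1
  entire : ∀ t ∈ I, EntireFamilyOn Φ c t
  entire_inv : ∀ t ∈ I, EntireFamilyOn Ψ c t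

namespace IsPropagator

variable {X : Type*} [NormedAddCommGroup X] [NormedSpace ℂ X] {I : Set ℝ} {K N : ℝ → X →L[ℂ] X}
  {c : ℝ}

/-- `Φ` and `Ψ` solve operator equations by left and by negated right multiplication. The derivative
of `ΨΦ` cancels, so `ΨΦ = 1`; then `ΦΨ` is a continuous idempotent equal to `1` at `c`. -/
theorem exists_of_segmentIntegrable [CompleteSpace X] (hI : I.OrdConnected)
    (hK : SegmentIntegrable K I) (hN : SegmentIntegrable N I) (hc : c ∈ I) :
    ∃ Φ Ψ : ℂ → ℝ → X →L[ℂ] X, IsPropagator K N I c Φ Ψ := by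
  obtain ⟨Φ, hΦ0, hΦ, hΦe⟩ := exists_entire_linear_solution hI
    (hN.clm (ContinuousLinearMap.compL ℂ X X X)) (hK.clm (ContinuousLinearMap.compL ℂ X X X)) hc
    (1 : X →L[ℂ] X)
  obtain ⟨Ψ, hΨ0, hΨ, hΨe⟩ := exists_entire_linear_solution hI
    (hN.clm (-(ContinuousLinearMap.compL ℂ X X X).flip))
    (hK.clm (-(ContinuousLinearMap.compL ℂ X X X).flip)) hc (1 : X →L[ℂ] X)
  have hΦ' : ∀ z, HasACDeriv (Φ z) (fun t => (N t + z • K t) ∘L Φ z t) I := fun z =>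
    (hΦ z).congr_deriv hI fun t _ => by
      simp [ContinuousLinearMap.add_comp]
  have hΨ' : ∀ z, HasACDeriv (Ψ z) (fun t => -(Ψ z t ∘L (N t + z • K t))) I := fun z =>
    (hΨ z).congr_deriv hI fun t _ => by
      simp [ContinuousLinearMap.comp_add]; abel
  have hΨΦ : ∀ z, ∀ t ∈ I, Ψ z t ∘L Φ z t = 1 := fun z t ht => by
    have h := ((hΨ' z).comp (hΦ' z)).eq_of_deriv_eq_zero hI (fun s _ => by
      simp [ContinuousLinearMap.comp_assoc]) hc ht
    rw [h, hΨ0, hΦ0]; rfl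
  refine ⟨Φ, Ψ, hΦ0, hΨ0, hΦ', hΨ', hΨΦ, fun z t ht => ?_, hΦe, hΨe⟩
  refine eq_one_of_idempotent_of_continuousOn hI (P := fun t => Φ z t ∘L Ψ z t)
    (((hΦ' z).locallyAC.comp (hΨ' z).locallyAC).continuousOn) (fun s hs => ?_) hc ?_ ht
  · change (Φ z s * Ψ z s) * (Φ z s * Ψ z s) = Φ z s * Ψ z s
    have h : Ψ z s * Φ z s = 1 := hΨΦ z s hs
    rw [mul_assoc, ← mul_assoc (Ψ z s), h, one_mul]
  · simp only [hΦ0, hΨ0]; rfl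

variable {Φ Ψ : ℂ → ℝ → X →L[ℂ] X}

/-- Uniqueness without Grönwall: `Ψ y` has zero derivative. -/
theorem eq_apply (h : IsPropagator K N I c Φ Ψ) (hI : I.OrdConnected) (hc : c ∈ I) {z : ℂ}
    {y : ℝ → X} (hy : HasACDeriv y (fun t => (N t + z • K t) (y t)) I) {t : ℝ} (ht : t ∈ I) :
    y t = Φ z t (y c) := by
  have h₁ := ((h.hasACDeriv_inv z).apply hy).eq_of_deriv_eq_zero hI (fun s _ => by simp) hc ht
  rw [h.init_inv] at h₁
  have h₂ := congrArg (fun T : X →L[ℂ] X => T (y t)) (h.comp_inv z t ht)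
  simp only [ContinuousLinearMap.comp_apply, h₁] at h₂
  simpa using h₂.symm

theorem isInvertible (h : IsPropagator K N I c Φ Ψ) (z : ℂ) {t : ℝ} (ht : t ∈ I) :
    (Φ z t).IsInvertible :=
  .of_inverse (h.comp_inv z t ht) (h.inv_comp z t ht)

theorem inverse_eq (h : IsPropagator K N I c Φ Ψ) (z : ℂ) {t : ℝ} (ht : t ∈ I) :
    (Φ z t).inverse = Ψ z t :=
  ContinuousLinearMap.inverse_eq (h.comp_inv z t ht) (h.inv_comp z t ht)

end IsPropagator

/-! ### Reduction of the ODE to normal form, and intertwining in terms of propagators -/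

namespace ODECoeff

variable {X Y : Type*} [NormedAddCommGroup X] [InnerProductSpace ℂ X]
  [NormedAddCommGroup Y] [InnerProductSpace ℂ Y]

/-- The coefficient `σ₁⁻¹ σ₂` of the equation solved for the derivative. -/
noncomputable def normalSpectral (p : ODECoeff X Y) (t : ℝ) : X →L[ℂ] X :=
  (p.σ₁ t).inverse ∘L p.σ₂ t

/-- The coefficient `σ₁⁻¹ γ` of the equation solved for the derivative. -/
noncomputable def normalFree (p : ODECoeff X Y) (t : ℝ) : X →L[ℂ] X :=
  (p.σ₁ t).inverse ∘L p.γ t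

namespace Regular

variable {p : ODECoeff X Y} {I : Set ℝ}

theorem comp_normalSpectral (hp : p.Regular I) {t : ℝ} (ht : t ∈ I) :
    p.σ₁ t ∘L p.normalSpectral t = p.σ₂ t := by
  rw [normalSpectral, ← ContinuousLinearMap.comp_assoc,
    (hp.invertible_σ₁ t ht).self_comp_inverse, ContinuousLinearMap.id_comp]

theorem comp_normalFree (hp : p.Regular I) {t : ℝ} (ht : t ∈ I) :
    p.σ₁ t ∘L p.normalFree t = p.γ t := by
  rw [normalFree, ← ContinuousLinearMap.comp_assoc,
    (hp.invertible_σ₁ t ht).self_comp_inverse, ContinuousLinearMap.id_comp]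

theorem segmentIntegrable_normalSpectral [CompleteSpace X] (hp : p.Regular I)
    (hI : I.OrdConnected) : SegmentIntegrable p.normalSpectral I :=
  (hp.locallyAC_σ₁.inverse hI hp.invertible_σ₁).comp_segmentIntegrable
    (.of_locallyIntegrableOn hI hp.locallyIntegrable_σ₂)

theorem segmentIntegrable_normalFree [CompleteSpace X] (hp : p.Regular I)
    (hI : I.OrdConnected) : SegmentIntegrable p.normalFree I :=
  (hp.locallyAC_σ₁.inverse hI hp.invertible_σ₁).comp_segmentIntegrable
    (.of_locallyIntegrableOn hI hp.locallyIntegrable_γ)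

theorem exists_isPropagator [CompleteSpace X] (hp : p.Regular I) (hI : I.OrdConnected) {c : ℝ}
    (hc : c ∈ I) : ∃ Φ Ψ, IsPropagator p.normalSpectral p.normalFree I c Φ Ψ :=
  IsPropagator.exists_of_segmentIntegrable hI (hp.segmentIntegrable_normalSpectral hI)
    (hp.segmentIntegrable_normalFree hI) hc

theorem isSolution_iff (hp : p.Regular I) (hI : I.OrdConnected) {z : ℂ} {u : ℝ → X} :
    p.IsSolution I z u ↔
      HasACDeriv u (fun t => (p.normalFree t + z • p.normalSpectral t) (u t)) I := by
  constructor
  · rintro ⟨hac, h⟩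
    refine ⟨hac, ?_⟩
    filter_upwards [h, ae_restrict_mem hI.measurableSet] with t ⟨u', hu', heq⟩ ht
    convert hu' using 1
    have h₁ : p.σ₁ t u' = z • p.σ₂ t (u t) + p.γ t (u t) := by
      rw [← sub_eq_zero, ← neg_eq_zero, ← heq]; abel
    rw [← (hp.invertible_σ₁ t ht).inverse_apply_self u', h₁]
    simp [normalFree, normalSpectral, add_comm]
  · rintro ⟨hac, h⟩
    refine ⟨hac, ?_⟩
    filter_upwards [h, ae_restrict_mem hI.measurableSet] with t hu' ht
    refine ⟨_, hu', ?_⟩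
    simp [normalFree, normalSpectral, (hp.invertible_σ₁ t ht).self_apply_inverse]

variable {c : ℝ} {Φ Ψ : ℂ → ℝ → X →L[ℂ] X}

theorem isFundamental_of_isPropagator (hp : p.Regular I) (hI : I.OrdConnected)
    (h : IsPropagator p.normalSpectral p.normalFree I c Φ Ψ) : p.IsFundamental I c Φ := by
  refine ⟨h.init, fun z t ht => h.isInvertible z ht, fun z => (h.hasACDeriv z).locallyAC,
    fun z => ?_⟩
  filter_upwards [(h.hasACDeriv z).hasDerivAt, ae_restrict_mem hI.measurableSet] with t hΦ' ht
  refine ⟨_, hΦ', ?_⟩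
  ext v
  simp [normalFree, normalSpectral, (hp.invertible_σ₁ t ht).self_apply_inverse]

theorem isSolution_apply (hp : p.Regular I) (hI : I.OrdConnected)
    (h : IsPropagator p.normalSpectral p.normalFree I c Φ Ψ) (z : ℂ) (v : X) :
    p.IsSolution I z (fun t => Φ z t v) :=
  (hp.isSolution_iff hI).2 ((h.hasACDeriv z).apply_const v)

theorem isSolution_of_isFundamental {Φ' : ℂ → ℝ → X →L[ℂ] X} (h : p.IsFundamental I c Φ') (z : ℂ)
    (v : X) : p.IsSolution I z (fun t => Φ' z t v) := by
  refine ⟨(h.locallyAC z).bilin (ContinuousLinearMap.id ℂ (X →L[ℂ] X)) (LocallyAC.const I v), ?_⟩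
  filter_upwards [h.eq z] with t ⟨D, hD, heq⟩
  refine ⟨D v, ?_, by simpa using congrArg (fun T : X →L[ℂ] Y => T v) heq⟩
  simpa using ContinuousLinearMap.hasDerivAt_of_bilinear
    (B := (ContinuousLinearMap.id ℂ (X →L[ℂ] X)).bilinearRestrictScalars ℝ)
      (fun _ => hD) (fun _ => hasDerivAt_const t v)

/-- Allows the contour formulas, stated for arbitrary fundamental solutions, to be proved for the
constructed propagator. -/
theorem isFundamental_eq (hp : p.Regular I) (hI : I.OrdConnected) (hc : c ∈ I)
    (h : IsPropagator p.normalSpectral p.normalFree I c Φ Ψ) {Φ' : ℂ → ℝ → X →L[ℂ] X}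
    (h' : p.IsFundamental I c Φ') (z : ℂ) {t : ℝ} (ht : t ∈ I) : Φ' z t = Φ z t := by
  ext v
  have := h.eq_apply hI hc ((hp.isSolution_iff hI).1 (isSolution_of_isFundamental h' z v)) ht
  simpa [h'.initial z] using this

end Regular

end ODECoeff

/-- `S Φ v` solves the output equation, hence equals `Φs` applied to its value at `c`. -/
theorem IsIntertwining.eq_comp {E Et Es Ets : Type*}
    [NormedAddCommGroup E] [InnerProductSpace ℂ E]
    [NormedAddCommGroup Et] [InnerProductSpace ℂ Et]
    [NormedAddCommGroup Es] [InnerProductSpace ℂ Es]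
    [NormedAddCommGroup Ets] [InnerProductSpace ℂ Ets]
    {p : ODECoeff E Et} {q : ODECoeff Es Ets} {I : Set ℝ} {Ω : Set ℂ} {S : ℂ → ℝ → E →L[ℂ] Es}
    (hS : IsIntertwining p q I Ω S) (hI : I.OrdConnected) (hp : p.Regular I) (hq : q.Regular I)
    {c : ℝ} (hc : c ∈ I) {Φ Ψ : ℂ → ℝ → E →L[ℂ] E} {Φs Ψs : ℂ → ℝ → Es →L[ℂ] Es}
    (h : IsPropagator p.normalSpectral p.normalFree I c Φ Ψ)
    (hs : IsPropagator q.normalSpectral q.normalFree I c Φs Ψs) {z : ℂ} (hz : z ∈ Ω) {t : ℝ}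
    (ht : t ∈ I) : S z t = Φs z t ∘L S z c ∘L Ψ z t := by
  have key : S z t ∘L Φ z t = Φs z t ∘L S z c := by
    ext v
    have := hs.eq_apply hI hc ((hq.isSolution_iff hI).1
      (hS.maps_solutions z hz _ (hp.isSolution_apply hI h z v))) ht
    simpa [h.init z] using this
  rw [← ContinuousLinearMap.comp_assoc, ← key, ContinuousLinearMap.comp_assoc, h.comp_inv z t ht]
  rfl

/-! ### Contour integrals of the resolvent -/

section Resolvent

variable {𝔸 : Type*} [NormedRing 𝔸] [NormedAlgebra ℂ 𝔸]

theorem resolvent_mul_algebraMap_sub {a : 𝔸} {z : ℂ} (hz : z ∉ spectrum ℂ a) :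
    resolvent a z * (algebraMap ℂ 𝔸 z - a) = 1 :=
  Ring.inverse_mul_cancel _ (spectrum.notMem_iff.1 hz)

theorem algebraMap_sub_mul_resolvent {a : 𝔸} {z : ℂ} (hz : z ∉ spectrum ℂ a) :
    (algebraMap ℂ 𝔸 z - a) * resolvent a z = 1 :=
  Ring.mul_inverse_cancel _ (spectrum.notMem_iff.1 hz)

variable [CompleteSpace 𝔸]

theorem differentiableAt_resolvent {a : 𝔸} {z : ℂ} (hz : z ∉ spectrum ℂ a) :
    DifferentiableAt ℂ (resolvent a) z :=
  (spectrum.hasDerivAt_resolvent_const_left (spectrum.notMem_iff.1 hz)).differentiableAt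

/-- The circle may be enlarged outside the spectrum. There `R(z) - (z - c)⁻¹ = (z - c)⁻¹ R(z) (a -
c)`, and since `R(z) → 0` at infinity the integral of this difference is arbitrarily small. -/
theorem circleIntegral_resolvent {a : 𝔸} {c : ℂ} {r : ℝ} (hr : 0 < r)
    (ha : spectrum ℂ a ⊆ Metric.ball c r) :
    (∮ z in C(c, r), resolvent a z) = (2 * Real.pi * Complex.I : ℂ) • (1 : 𝔸) := by
  have hout : ∀ z, r ≤ ‖z - c‖ → z ∉ spectrum ℂ a := fun z hz hzs => by
    have := ha hzs
    rw [Metric.mem_ball, dist_eq_norm] at this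
    linarith
  have hdef : ∀ ρ, r ≤ ρ → (∮ z in C(c, ρ), resolvent a z) = ∮ z in C(c, r), resolvent a z := by
    intro ρ hρ
    refine Complex.circleIntegral_eq_of_differentiable_on_annulus_off_countable hr hρ
      Set.countable_empty (fun z hz => ?_) fun z hz => ?_
    · exact (differentiableAt_resolvent (hout z
        (by simpa [dist_eq_norm] using hz.2))).continuousAt.continuousWithinAt
    · refine differentiableAt_resolvent (hout z (le_of_lt ?_))
      simpa [dist_eq_norm] using hz.1.2
  rw [← sub_eq_zero, ← norm_eq_zero]
  refine le_antisymm (le_of_forall_pos_le_add fun ε hε => ?_) (norm_nonneg _)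
  -- Chosen so that the circumference times the final bound is exactly `ε`; the `+ 1` keeps the
  -- denominator positive.
  set δ : ℝ := ε / (2 * Real.pi * (‖a - algebraMap ℂ 𝔸 c‖ + 1)) with hδ
  have hK : 0 < ‖a - algebraMap ℂ 𝔸 c‖ + 1 := by positivity
  have hδ0 : 0 < δ := by positivity
  have hev := (spectrum.resolvent_tendsto_cobounded (𝕜 := ℂ) a).norm
  rw [norm_zero] at hev
  obtain ⟨R₀, -, hR₀⟩ := (hasBasis_cobounded_norm (E := ℂ)).eventually_iff.1
    (hev.eventually (gt_mem_nhds hδ0))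
  set ρ := max r (R₀ + ‖c‖) with hρ
  have hρr : r ≤ ρ := le_max_left _ _
  have hρ0 : 0 < ρ := hr.trans_le hρr
  have hI₁ : (∮ z in C(c, ρ), (z - c)⁻¹ • (1 : 𝔸)) = (2 * Real.pi * Complex.I : ℂ) • (1 : 𝔸) := by
    rw [circleIntegral.integral_smul_const, circleIntegral.integral_sub_center_inv c hρ0.ne']
  have hci : CircleIntegrable (resolvent a) c ρ := by
    refine ContinuousOn.circleIntegrable hρ0.le fun z hz => ?_
    refine (differentiableAt_resolvent (hout z ?_)).continuousAt.continuousWithinAt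
    rw [mem_sphere_iff_norm.1 hz]; exact hρr
  have hci' : CircleIntegrable (fun z => (z - c)⁻¹ • (1 : 𝔸)) c ρ := by
    refine ContinuousOn.circleIntegrable hρ0.le
      (ContinuousOn.smul (ContinuousOn.inv₀ (by fun_prop) fun z hz h0 => ?_) continuousOn_const)
    rw [mem_sphere_iff_norm, h0, norm_zero] at hz
    exact hρ0.ne hz
  rw [← hdef ρ hρr, ← hI₁, ← circleIntegral.integral_sub hci hci']
  have hb : ∀ z ∈ Metric.sphere c ρ, ‖resolvent a z - (z - c)⁻¹ • (1 : 𝔸)‖ ≤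
      ρ⁻¹ * (δ * (‖a - algebraMap ℂ 𝔸 c‖ + 1)) := by
    intro z hz
    have hz' : ‖z - c‖ = ρ := mem_sphere_iff_norm.1 hz
    have hzc : z - c ≠ 0 := norm_ne_zero_iff.1 (by rw [hz']; exact hρ0.ne')
    have hzs := hout z (hz' ▸ hρr)
    have hbig : R₀ ≤ ‖z‖ := by
      have h₁ : ‖z - c‖ ≤ ‖z‖ + ‖c‖ := norm_sub_le _ _
      have h₂ : R₀ + ‖c‖ ≤ ρ := le_max_right _ _
      linarith
    have hid : resolvent a z - (z - c)⁻¹ • (1 : 𝔸) =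
        (z - c)⁻¹ • (resolvent a z * (a - algebraMap ℂ 𝔸 c)) := by
      have h₁ : (z - c) • resolvent a z = 1 + resolvent a z * (a - algebraMap ℂ 𝔸 c) := by
        rw [← resolvent_mul_algebraMap_sub hzs, ← mul_add, sub_add_sub_cancel, ← map_sub,
          ← Algebra.commutes, Algebra.smul_def]
      rw [eq_inv_smul_iff₀ hzc, smul_sub, h₁, smul_inv_smul₀ hzc, add_sub_cancel_left]
    rw [hid, norm_smul, norm_inv, hz']
    gcongr
    refine (norm_mul_le _ _).trans (mul_le_mul (hR₀ hbig).le (by linarith) (norm_nonneg _) hδ0.le)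
  refine (circleIntegral.norm_integral_le_of_norm_le_const hρ0.le hb).trans (le_of_eq ?_)
  rw [hδ, zero_add]
  field_simp

theorem hasSum_resolvent {a : 𝔸} {z : ℂ} (hz : ‖a‖ < ‖z‖) :
    HasSum (fun n : ℕ => z⁻¹ ^ (n + 1) • a ^ n) (resolvent a z) := by
  have hz0 : z ≠ 0 := norm_pos_iff.1 ((norm_nonneg a).trans_lt hz)
  have hlt : ‖z⁻¹ • a‖ < 1 := by
    rw [norm_smul, norm_inv, inv_mul_lt_one₀ (norm_pos_iff.2 hz0)]
    exact hz
  have hs : HasSum (fun n : ℕ => (z⁻¹ • a) ^ n) (∑' n : ℕ, (z⁻¹ • a) ^ n) :=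
    (summable_geometric_of_norm_lt_one hlt).hasSum
  have hfac : algebraMap ℂ 𝔸 z - a = z • (1 - z⁻¹ • a) := by
    rw [smul_sub, smul_inv_smul₀ hz0, Algebra.algebraMap_eq_smul_one]
  have hr : (algebraMap ℂ 𝔸 z - a) * (z⁻¹ • ∑' n : ℕ, (z⁻¹ • a) ^ n) = 1 := by
    rw [hfac, smul_mul_smul_comm, mul_inv_cancel₀ hz0, one_smul, mul_neg_geom_series _ hlt]
  have hl : (z⁻¹ • ∑' n : ℕ, (z⁻¹ • a) ^ n) * (algebraMap ℂ 𝔸 z - a) = 1 := by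
    rw [hfac, smul_mul_smul_comm, inv_mul_cancel₀ hz0, one_smul, geom_series_mul_neg _ hlt]
  have hR : resolvent a z = z⁻¹ • ∑' n : ℕ, (z⁻¹ • a) ^ n :=
    left_inv_eq_right_inv (Ring.inverse_mul_cancel _ ⟨⟨_, _, hr, hl⟩, rfl⟩) hr
  rw [hR]
  convert hs.const_smul z⁻¹ using 2 with n
  rw [smul_pow, smul_smul, pow_succ']

end Resolvent

/-! ### Realization of functions analytic at infinity -/

section Realization

variable {E : Type*} [NormedAddCommGroup E] [NormedSpace ℂ E]

theorem lp_two_summable_sq {E : Type*} [NormedAddCommGroup E] (x : lp (fun _ : ℕ => E) 2) :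
    Summable fun n => ‖x n‖ ^ 2 := by
  have := (lp.memℓp x).summable (by norm_num)
  simpa using this

/-- The backward shift on square summable sequences. -/
noncomputable def backwardShift (E : Type*) [NormedAddCommGroup E] [NormedSpace ℂ E] :
    lp (fun _ : ℕ => E) 2 →L[ℂ] lp (fun _ : ℕ => E) 2 :=
  LinearMap.mkContinuous
    { toFun := fun x => ⟨fun n => x (n + 1), memℓp_gen (by
        simpa using (summable_nat_add_iff 1).2 (lp_two_summable_sq x))⟩
      map_add' := fun x y => rfl
      map_smul' := fun a x => rfl } 1 fun x => by
    rw [one_mul]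
    refine lp.norm_le_of_tsum_le (by norm_num) (norm_nonneg x) ?_
    rw [lp.norm_rpow_eq_tsum (by norm_num) x]
    have hs := (lp_two_summable_sq x).tsum_eq_zero_add
    simp only [ENNReal.toReal_ofNat, Real.rpow_ofNat]
    rw [hs]
    exact le_add_of_nonneg_left (sq_nonneg _)

@[simp]
theorem backwardShift_apply (x : lp (fun _ : ℕ => E) 2) (n : ℕ) :
    backwardShift E x n = x (n + 1) := rfl

theorem backwardShift_pow_apply (x : lp (fun _ : ℕ => E) 2) (k n : ℕ) :
    (backwardShift E ^ k) x n = x (n + k) := by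
  induction k generalizing n with
  | zero => simp
  | succ k ih =>
    rw [pow_succ', mul_apply_eq_comp, backwardShift_apply, ih, add_right_comm, add_assoc]

theorem norm_lpSingle_le (k : ℕ) :
    ‖lp.singleContinuousLinearMap ℂ (fun _ : ℕ => E) 2 k‖ ≤ 1 := by
  refine ContinuousLinearMap.opNorm_le_bound _ zero_le_one fun v => ?_
  rw [lp.singleContinuousLinearMap_apply, lp.norm_single (by norm_num), one_mul]

theorem lpEval_comp_lpSingle (k j : ℕ) :
    lp.evalCLM ℂ (fun _ : ℕ => E) 2 k ∘L lp.singleContinuousLinearMap ℂ (fun _ : ℕ => E) 2 j =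
      if j = k then ContinuousLinearMap.id ℂ E else 0 := by
  ext v
  split_ifs with h
  · subst h
    exact lp.single_apply_self (E := fun _ : ℕ => E) 2 j v
  · exact lp.single_apply_ne (E := fun _ : ℕ => E) 2 j v (Ne.symm h)

theorem lpEval_comp_backwardShift_pow (k : ℕ) :
    lp.evalCLM ℂ (fun _ : ℕ => E) 2 0 ∘L (backwardShift E ^ k) =
      lp.evalCLM ℂ (fun _ : ℕ => E) 2 k := by
  ext x
  exact (backwardShift_pow_apply x k 0).trans (by rw [zero_add]; rfl)

end Realization

/-- A function analytic at `∞` is the transfer function of a constant system on a Hilbert space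
that carries coordinates `ev k` and a backward shift. -/
theorem AnalyticAt.exists_realization_of_shift {E Et Es : Type*} [NormedAddCommGroup E]
    [InnerProductSpace ℂ E] [NormedAddCommGroup Et] [InnerProductSpace ℂ Et]
    [NormedAddCommGroup Es] [InnerProductSpace ℂ Es]
    {H : Type*} [NormedAddCommGroup H] [InnerProductSpace ℂ H] [CompleteSpace H]
    {e : ℕ → Es →L[ℂ] H} {ev : ℕ → H →L[ℂ] Es} {shift : H →L[ℂ] H} (he : ∀ k, ‖e k‖ ≤ 1)
    (hev : ∀ k j, ev k ∘L e j = if j = k then ContinuousLinearMap.id ℂ Es else 0)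
    (hshift : ∀ k, ev 0 ∘L (shift ^ k) = ev k) {g : ℂ → E →L[ℂ] Es}
    (hg : AnalyticAt ℂ g 0) {σ : E →L[ℂ] Et} (hσ : σ.IsInvertible) :
    ∃ (A : H →L[ℂ] H)
      (B : Et →L[ℂ] H) (C : H →L[ℂ] Es)
      (D : E →L[ℂ] Es), ∀ᶠ z in cobounded ℂ, g z⁻¹ = realizationValue A B C D σ z := by
  obtain ⟨P, r, hP⟩ := hg
  obtain ⟨r', hr'0, hr'⟩ := ENNReal.lt_iff_exists_nnreal_btwn.1 hP.r_pos
  have hr'pos : (0 : ℝ) < r' := by exact_mod_cast hr'0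
  obtain ⟨M, hM0, hM⟩ := P.norm_mul_pow_le_of_lt_radius (hr'.trans_le hP.r_le)
  -- Halving a radius at which the coefficients are controlled makes `ρ ^ k P_{k+1}` decay like `2 ^
  -- (-k)`, so the sum defining `B` converges. The factor `ρ⁻¹` in `A` compensates.
  set ρ : ℝ := r' / 2 with hρ
  have hρ0 : 0 < ρ := by positivity
  have hρc : (ρ : ℂ) ≠ 0 := by exact_mod_cast hρ0.ne'
  have hsum : Summable fun k : ℕ => (ρ : ℂ) ^ k • (e k ∘L P.coeff (k + 1)) := by
    refine Summable.of_norm_bounded (g := fun k : ℕ => M / r' * (1 / 2) ^ k)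
      (summable_geometric_two.mul_left _) fun k => ?_
    have he' : ‖e k ∘L P.coeff (k + 1)‖ ≤ ‖P.coeff (k + 1)‖ :=
      (ContinuousLinearMap.opNorm_comp_le _ _).trans
        (mul_le_of_le_one_left (norm_nonneg _) (he k))
    rw [norm_smul, norm_pow, Complex.norm_real, Real.norm_of_nonneg hρ0.le]
    have h₁ := hM (k + 1)
    rw [FormalMultilinearSeries.norm_apply_eq_norm_coef] at h₁
    calc ρ ^ k * ‖e k ∘L P.coeff (k + 1)‖ ≤ ρ ^ k * ‖P.coeff (k + 1)‖ := by gcongr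
      _ = (‖P.coeff (k + 1)‖ * (r' : ℝ) ^ (k + 1)) / r' * (1 / 2) ^ k := by
        rw [hρ, div_pow, div_pow, one_pow, pow_succ]; field_simp
      _ ≤ M / r' * (1 / 2) ^ k := by gcongr
  let B : E →L[ℂ] H := ∑' k : ℕ, (ρ : ℂ) ^ k • (e k ∘L P.coeff (k + 1))
  have hB : ∀ k, ev k ∘L B = (ρ : ℂ) ^ k • P.coeff (k + 1) := by
    intro k
    have h₁ := hsum.hasSum.mapL (ContinuousLinearMap.compL ℂ E H Es (ev k))
    refine h₁.unique ?_
    have h₂ : ∀ j, ev k ∘L ((ρ : ℂ) ^ j • (e j ∘L P.coeff (j + 1))) =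
        if j = k then (ρ : ℂ) ^ k • P.coeff (k + 1) else 0 := fun j => by
      rw [ContinuousLinearMap.comp_smul, ← ContinuousLinearMap.comp_assoc, hev]
      split_ifs with h
      · rw [h, ContinuousLinearMap.id_comp]
      · rw [ContinuousLinearMap.zero_comp, smul_zero]
    simp only [ContinuousLinearMap.compL_apply, h₂]
    exact hasSum_ite_eq k _
  let A : H →L[ℂ] H := (ρ : ℂ)⁻¹ • shift
  have hAB : ∀ k, ev 0 ∘L (A ^ k) ∘L B = P.coeff (k + 1) := by
    intro k
    have h₁ : ev 0 ∘L (A ^ k) = (ρ : ℂ)⁻¹ ^ k • ev k := by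
      rw [smul_pow, ContinuousLinearMap.comp_smul, hshift]
    rw [← ContinuousLinearMap.comp_assoc, h₁, ContinuousLinearMap.smul_comp, hB, smul_smul,
      ← mul_pow, inv_mul_cancel₀ hρc, one_pow, one_smul]
  -- The realization has `σ` to the right of the input operator, hence the factor `σ⁻¹`.
  refine ⟨A, B ∘L σ.inverse, ev 0, P.coeff 0, ?_⟩
  have hball : ∀ᶠ z in cobounded ℂ, z⁻¹ ∈ Metric.eball (0 : ℂ) r :=
    tendsto_inv₀_cobounded.eventually (Metric.eball_mem_nhds _ hP.r_pos)
  have hbig : ∀ᶠ z in cobounded ℂ, ‖A‖ < ‖z‖ :=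
    (tendsto_norm_cobounded_atTop (E := ℂ)).eventually_gt_atTop ‖A‖
  filter_upwards [hball, hbig] with z hz hAz
  have h₁ := hP.hasSum hz
  rw [zero_add] at h₁
  -- With the constant term moved to the feedthrough, the remaining powers match the Neumann series
  -- `∑ z⁻¹ ^ (n + 1) A ^ n`.
  have h₂ := (hasSum_nat_add_iff' 1).2 h₁
  rw [Finset.sum_range_one] at h₂
  have h₃ := ((hasSum_resolvent hAz).mapL ((ContinuousLinearMap.compL ℂ _ _ Es) (ev 0))).mapL
    ((ContinuousLinearMap.compL ℂ E _ Es).flip B)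
  have h₄ : g z⁻¹ - P.coeff 0 = ev 0 ∘L resolvent A z ∘L B := by
    refine HasSum.unique ?_ h₃
    convert h₂ using 1
    · funext n
      rw [FormalMultilinearSeries.apply_eq_pow_smul_coeff, ← hAB n]
      ext v; simp
    · rw [FormalMultilinearSeries.apply_eq_pow_smul_coeff, pow_zero, one_smul]
  rw [realizationValue, ContinuousLinearMap.comp_assoc,
    ContinuousLinearMap.IsInvertible.inverse_comp_self hσ,
    ContinuousLinearMap.comp_id, ← h₄]
  abel

/-- The Hilbert space `ℓ²` with its coordinates and its backward shift. -/
theorem exists_hilbert_shift (E : Type uE) [NormedAddCommGroup E] [InnerProductSpace ℂ E]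
    [CompleteSpace E] :
    ∃ (H : Type uE) (_ : NormedAddCommGroup H) (_ : InnerProductSpace ℂ H) (_ : CompleteSpace H)
      (e : ℕ → E →L[ℂ] H) (ev : ℕ → H →L[ℂ] E) (shift : H →L[ℂ] H),
      (∀ k, ‖e k‖ ≤ 1) ∧
      (∀ k j, ev k ∘L e j = if j = k then ContinuousLinearMap.id ℂ E else 0) ∧
      ∀ k, ev 0 ∘L (shift ^ k) = ev k := by
  refine ⟨lp (fun _ : ℕ => E) 2, inferInstance, inferInstance, inferInstance,
    lp.singleContinuousLinearMap ℂ (fun _ : ℕ => E) 2, lp.evalCLM ℂ (fun _ : ℕ => E) 2,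
    backwardShift E, ?_, ?_, ?_⟩
  · exact norm_lpSingle_le
  · exact lpEval_comp_lpSingle
  · exact lpEval_comp_backwardShift_pow

/-! ### Vessel operators -/

/-- The entire part integrates to zero by Cauchy, and `T` commutes with the integral. This recovers
a vessel operator from its contour formula. -/
theorem inv_smul_circleIntegral_eq {𝔸 G : Type*} [NormedRing 𝔸] [NormedAlgebra ℂ 𝔸]
    [CompleteSpace 𝔸] [NormedAddCommGroup G] [NormedSpace ℂ G] [CompleteSpace G] {a : 𝔸} {c : ℂ}
    {r : ℝ} (hr : 0 < r) (ha : spectrum ℂ a ⊆ Metric.ball c r) (T : 𝔸 →L[ℂ] G) {f e : ℂ → G}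
    (he : Differentiable ℂ e) (hf : ∀ z, z ∉ spectrum ℂ a → f z = T (resolvent a z) + e z) :
    (2 * Real.pi * Complex.I : ℂ)⁻¹ • (∮ z in C(c, r), f z) = T 1 := by
  have hout : ∀ z ∈ Metric.sphere c r, z ∉ spectrum ℂ a := fun z hz hzs => by
    have := Metric.mem_ball.1 (ha hzs)
    rw [Metric.mem_sphere.1 hz] at this
    exact lt_irrefl _ this
  have hci : CircleIntegrable (resolvent a) c r := ContinuousOn.circleIntegrable hr.le fun z hz =>
    (differentiableAt_resolvent (hout z hz)).continuousAt.continuousWithinAt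
  have hT : (∮ z in C(c, r), T (resolvent a z)) = T (∮ z in C(c, r), resolvent a z) := by
    simp only [circleIntegral]
    rw [← T.intervalIntegral_comp_comm hci.out]
    simp
  have hTi : CircleIntegrable (fun z => T (resolvent a z)) c r :=
    ContinuousOn.circleIntegrable hr.le fun z hz =>
      T.continuous.continuousAt.comp_continuousWithinAt
        (differentiableAt_resolvent (hout z hz)).continuousAt.continuousWithinAt
  have he0 : (∮ z in C(c, r), e z) = 0 :=
    Complex.circleIntegral_eq_zero_of_differentiable_on_off_countable hr.le Set.countable_empty
      he.continuous.continuousOn fun z _ => he z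
  rw [circleIntegral.integral_congr hr.le fun z hz => hf z (hout z hz),
    circleIntegral.integral_add hTi (he.continuous.continuousOn.circleIntegrable hr.le), he0,
    add_zero, hT, circleIntegral_resolvent hr ha, map_smul, smul_smul,
    inv_mul_cancel₀ Complex.two_pi_I_ne_zero, one_smul]

section VesselOperators

variable {X H : Type*} [NormedAddCommGroup X] [NormedSpace ℂ X]
  [NormedAddCommGroup H] [NormedSpace ℂ H]
  {I : Set ℝ} {K N : ℝ → X →L[ℂ] X} {c : ℝ} {Φ Ψ : ℂ → ℝ → X →L[ℂ] X}

/-- The output operator `C` of the vessel: `C' = K C A + N C`. -/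
theorem exists_outputOperator [CompleteSpace X] (hI : I.OrdConnected) (hK : SegmentIntegrable K I)
    (hN : SegmentIntegrable N I) (hc : c ∈ I) (A : H →L[ℂ] H) (C₀ : H →L[ℂ] X) :
    ∃ C : ℝ → H →L[ℂ] X, C c = C₀ ∧
      HasACDeriv C (fun t => K t ∘L C t ∘L A + N t ∘L C t) I := by
  -- No spectral parameter is needed here: `L₁` is zero and the solution is read off at `z = 0`.
  obtain ⟨C, hC0, hC, -⟩ := exists_entire_linear_solution hI
    (((hK.clm (ContinuousLinearMap.compL ℂ H X X)).comp_locallyAC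
      (LocallyAC.const I ((ContinuousLinearMap.compL ℂ H H X).flip A))).add
      (hN.clm (ContinuousLinearMap.compL ℂ H X X)))
    (L₁ := fun _ => 0) (fun _ _ _ _ => intervalIntegrable_const) hc C₀
  exact ⟨C 0, hC0 0, (hC 0).congr_deriv hI fun t _ => by simp⟩

/-- The input operator `F = B σ₁` of the vessel: `F' = -(A F K + F N)`. -/
theorem exists_inputOperator [CompleteSpace H] (hI : I.OrdConnected) (hK : SegmentIntegrable K I)
    (hN : SegmentIntegrable N I) (hc : c ∈ I) (A : H →L[ℂ] H) (F₀ : X →L[ℂ] H) :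
    ∃ F : ℝ → X →L[ℂ] H, F c = F₀ ∧
      HasACDeriv F (fun t => -(A ∘L F t ∘L K t + F t ∘L N t)) I := by
  obtain ⟨F, hF0, hF, -⟩ := exists_entire_linear_solution hI
    (((LocallyAC.const I (-ContinuousLinearMap.compL ℂ X H H A)).comp_segmentIntegrable
      (hK.clm (ContinuousLinearMap.compL ℂ X X H).flip)).add
      (hN.clm (-(ContinuousLinearMap.compL ℂ X X H).flip)))
    (L₁ := fun _ => 0) (fun _ _ _ _ => intervalIntegrable_const) hc F₀
  exact ⟨F 0, hF0 0, (hF 0).congr_deriv hI fun t _ => by simp; abel⟩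

/-- `(Ψ C)' = -Ψ K C (z - A)`, so `V` is the primitive of `Ψ K C`, entire in `z` because `Ψ` is. -/
theorem IsPropagator.exists_entire_output [CompleteSpace X] (h : IsPropagator K N I c Φ Ψ)
    (hI : I.OrdConnected) (hK : SegmentIntegrable K I) (hc : c ∈ I) {A : H →L[ℂ] H}
    {C : ℝ → H →L[ℂ] X}
    (hC : HasACDeriv C (fun t => K t ∘L C t ∘L A + N t ∘L C t) I) :
    ∃ V : ℂ → ℝ → H →L[ℂ] X, (∀ t ∈ I, Differentiable ℂ fun z => V z t) ∧
      ∀ z, ∀ t ∈ I, C c = Ψ z t ∘L C t + V z t ∘L (algebraMap ℂ (H →L[ℂ] H) z - A) := by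
  have hg : SegmentIntegrable (fun s => (ContinuousLinearMap.compL ℂ H X X).flip (K s ∘L C s)) I :=
    (hK.comp_locallyAC hC.locallyAC).clm _
  refine ⟨fun z t => ∫ s in c..t, (ContinuousLinearMap.compL ℂ H X X).flip (K s ∘L C s) (Ψ z s),
    fun t ht => (h.entire_inv t ht).differentiable_integral (hg c hc t ht), fun z t ht => ?_⟩
  have hV := HasACDeriv.integral hI (hg.bilin_locallyAC
    (ContinuousLinearMap.id ℂ _) (h.hasACDeriv_inv z).locallyAC) hc
  have hD := (((h.hasACDeriv_inv z).comp hC).add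
    (hV.comp_const (algebraMap ℂ (H →L[ℂ] H) z - A))).eq_of_deriv_eq_zero hI (fun s _ => ?_) hc ht
  · simpa [h.init_inv z, ContinuousLinearMap.one_def] using hD.symm
  · ext v
    simp [Algebra.algebraMap_eq_smul_one]
    abel

/-- Dually, `(F Φ)' = (z - A) F K Φ`, and `W` is the primitive of `F K Φ`. -/
theorem IsPropagator.exists_entire_input [CompleteSpace H] (h : IsPropagator K N I c Φ Ψ)
    (hI : I.OrdConnected) (hK : SegmentIntegrable K I) (hc : c ∈ I) {A : H →L[ℂ] H}
    {F : ℝ → X →L[ℂ] H}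
    (hF : HasACDeriv F (fun t => -(A ∘L F t ∘L K t + F t ∘L N t)) I) :
    ∃ W : ℂ → ℝ → X →L[ℂ] H, (∀ t ∈ I, Differentiable ℂ fun z => W z t) ∧
      ∀ z, ∀ t ∈ I, F c = F t ∘L Φ z t - (algebraMap ℂ (H →L[ℂ] H) z - A) ∘L W z t := by
  have hFK : SegmentIntegrable (fun s => F s ∘L K s) I := hF.locallyAC.comp_segmentIntegrable hK
  have hg := SegmentIntegrable.clm (V := X →L[ℂ] H) (W := (X →L[ℂ] X) →L[ℂ] X →L[ℂ] H)
    (ContinuousLinearMap.compL ℂ X X H) hFK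
  refine ⟨fun z t => ∫ s in c..t, (F s ∘L K s) ∘L Φ z s,
    fun t ht => (h.entire t ht).differentiable_integral (hg c hc t ht), fun z t ht => ?_⟩
  have hW := HasACDeriv.integral hI (hFK.comp_locallyAC (h.hasACDeriv z).locallyAC) hc
  have hD := ((hF.comp (h.hasACDeriv z)).sub
    (hW.const_comp (algebraMap ℂ (H →L[ℂ] H) z - A))).eq_of_deriv_eq_zero hI (fun s _ => ?_) hc ht
  · simpa [h.init z, ContinuousLinearMap.one_def] using hD.symm
  · ext v
    simp [Algebra.algebraMap_eq_smul_one]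
    abel

end VesselOperators

/-! ### The evolved transfer function and its feedthrough operator -/

section Transfer

variable {E Es H : Type*} [NormedAddCommGroup E] [NormedSpace ℂ E] [NormedAddCommGroup Es]
  [NormedSpace ℂ Es] [NormedAddCommGroup H] [NormedSpace ℂ H]

theorem comp_resolvent_eq {A : H →L[ℂ] H} {z : ℂ} (hz : z ∉ spectrum ℂ A)
    {Φs Ψs : Es →L[ℂ] Es} {C₀ C V : H →L[ℂ] Es} (hΦs : Φs ∘L Ψs = 1)
    (hC : C₀ = Ψs ∘L C + V ∘L (algebraMap ℂ (H →L[ℂ] H) z - A)) :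
    Φs ∘L C₀ ∘L resolvent A z = C ∘L resolvent A z + Φs ∘L V := by
  have hR : (algebraMap ℂ (H →L[ℂ] H) z - A) ∘L resolvent A z = 1 :=
    algebraMap_sub_mul_resolvent hz
  rw [hC, ContinuousLinearMap.add_comp, ContinuousLinearMap.comp_add,
    ContinuousLinearMap.comp_assoc V, hR, ContinuousLinearMap.comp_assoc Ψs,
    ← ContinuousLinearMap.comp_assoc Φs Ψs, hΦs]
  rfl

theorem resolvent_comp_eq {A : H →L[ℂ] H} {z : ℂ} (hz : z ∉ spectrum ℂ A)
    {Φ Ψ : E →L[ℂ] E} {F₀ F W : E →L[ℂ] H} (hΦ : Φ ∘L Ψ = 1)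
    (hF : F₀ = F ∘L Φ - (algebraMap ℂ (H →L[ℂ] H) z - A) ∘L W) :
    resolvent A z ∘L F₀ ∘L Ψ = resolvent A z ∘L F - W ∘L Ψ := by
  have hR : resolvent A z ∘L (algebraMap ℂ (H →L[ℂ] H) z - A) = 1 :=
    resolvent_mul_algebraMap_sub hz
  rw [hF, ContinuousLinearMap.sub_comp, ContinuousLinearMap.comp_sub,
    ContinuousLinearMap.comp_assoc F, hΦ, ContinuousLinearMap.comp_assoc _ W,
    ← ContinuousLinearMap.comp_assoc _ _ (W ∘L Ψ), hR]
  rfl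

/-- Each factor `z - A` in the conservation laws cancels the resolvent, so the bracket on the right
contains no resolvent and is entire in `z`. -/
theorem transfer_eq {A : H →L[ℂ] H} {z : ℂ} (hz : z ∉ spectrum ℂ A)
    {Φs Ψs : Es →L[ℂ] Es} {C₀ C V : H →L[ℂ] Es} {Φ Ψ : E →L[ℂ] E} {F₀ F W : E →L[ℂ] H}
    (D₀ : E →L[ℂ] Es) (hΦs : Φs ∘L Ψs = 1) (hΦ : Φ ∘L Ψ = 1)
    (hC : C₀ = Ψs ∘L C + V ∘L (algebraMap ℂ (H →L[ℂ] H) z - A))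
    (hF : F₀ = F ∘L Φ - (algebraMap ℂ (H →L[ℂ] H) z - A) ∘L W) :
    Φs ∘L (D₀ + C₀ ∘L resolvent A z ∘L F₀) ∘L Ψ = C ∘L resolvent A z ∘L F +
      (Φs ∘L D₀ ∘L Ψ + Φs ∘L V ∘L F - Φs ∘L C₀ ∘L W ∘L Ψ) := by
  have h₁ := comp_resolvent_eq hz hΦs hC
  have h₂ := resolvent_comp_eq hz hΦ hF
  have h₃ : Φs ∘L C₀ ∘L resolvent A z ∘L F = C ∘L resolvent A z ∘L F + Φs ∘L V ∘L F := by
    have := congrArg (fun T => T ∘L F) h₁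
    simpa only [ContinuousLinearMap.add_comp, ContinuousLinearMap.comp_assoc] using this
  have h₄ : (C₀ ∘L resolvent A z ∘L F₀) ∘L Ψ = C₀ ∘L (resolvent A z ∘L F₀ ∘L Ψ) := by
    simp only [ContinuousLinearMap.comp_assoc]
  rw [ContinuousLinearMap.add_comp, h₄, h₂, ContinuousLinearMap.comp_add,
    ContinuousLinearMap.comp_sub, ContinuousLinearMap.comp_sub, h₃]
  abel

variable {I : Set ℝ} {c : ℝ}
  {K N : ℝ → E →L[ℂ] E} {Ks Ns : ℝ → Es →L[ℂ] Es} {Φ Ψ : ℂ → ℝ → E →L[ℂ] E}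
  {Φs Ψs : ℂ → ℝ → Es →L[ℂ] Es} {A : H →L[ℂ] H} {C : ℝ → H →L[ℂ] Es} {F : ℝ → E →L[ℂ] H}

theorem Differentiable.clm_comp_const {U V W : Type*} [NormedAddCommGroup U] [NormedSpace ℂ U]
    [NormedAddCommGroup V] [NormedSpace ℂ V] [NormedAddCommGroup W] [NormedSpace ℂ W]
    {f : ℂ → V →L[ℂ] W} (hf : Differentiable ℂ f) (T : U →L[ℂ] V) :
    Differentiable ℂ fun z => f z ∘L T :=
  hf.clm_comp (differentiable_const T)

theorem Differentiable.const_clm_comp {U V W : Type*} [NormedAddCommGroup U] [NormedSpace ℂ U]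
    [NormedAddCommGroup V] [NormedSpace ℂ V] [NormedAddCommGroup W] [NormedSpace ℂ W]
    {f : ℂ → U →L[ℂ] V} (hf : Differentiable ℂ f) (T : V →L[ℂ] W) :
    Differentiable ℂ fun z => T ∘L f z :=
  (differentiable_const T).clm_comp hf

/-- If the evolved transfer function has a limit at `∞`, it is the transfer function with the
evolved operators `C` and `F` and with that limit as feedthrough. -/
theorem eq_limit_add_transfer [CompleteSpace Es] [CompleteSpace H]
    (hI : I.OrdConnected) (hc : c ∈ I)
    (hK : SegmentIntegrable K I) (hKs : SegmentIntegrable Ks I)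
    (h : IsPropagator K N I c Φ Ψ) (hs : IsPropagator Ks Ns I c Φs Ψs)
    (hC : HasACDeriv C (fun t => Ks t ∘L C t ∘L A + Ns t ∘L C t) I)
    (hF : HasACDeriv F (fun t => -(A ∘L F t ∘L K t + F t ∘L N t)) I) {D₀ : E →L[ℂ] Es}
    {t : ℝ} (ht : t ∈ I) {D : E →L[ℂ] Es}
    (hlim : Tendsto (fun z => Φs z t ∘L (D₀ + C c ∘L resolvent A z ∘L F c) ∘L Ψ z t)
      (cobounded ℂ) (𝓝 D)) {z : ℂ} (hz : z ∉ spectrum ℂ A) :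
    Φs z t ∘L (D₀ + C c ∘L resolvent A z ∘L F c) ∘L Ψ z t = D + C t ∘L resolvent A z ∘L F t := by
  obtain ⟨V, hVd, hV⟩ := hs.exists_entire_output hI hKs hc hC
  obtain ⟨W, hWd, hW⟩ := h.exists_entire_input hI hK hc hF
  have key : ∀ w, w ∉ spectrum ℂ A →
      Φs w t ∘L (D₀ + C c ∘L resolvent A w ∘L F c) ∘L Ψ w t = C t ∘L resolvent A w ∘L F t +
        (Φs w t ∘L D₀ ∘L Ψ w t + Φs w t ∘L V w t ∘L F t - Φs w t ∘L C c ∘L W w t ∘L Ψ w t) :=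
    fun w hw => transfer_eq hw D₀ (hs.comp_inv w t ht) (h.comp_inv w t ht) (hV w t ht) (hW w t ht)
  have hΦs := (hs.entire t ht).differentiable t Set.right_mem_uIcc
  have hΨ := (h.entire_inv t ht).differentiable t Set.right_mem_uIcc
  have hent : Differentiable ℂ fun w => Φs w t ∘L D₀ ∘L Ψ w t + Φs w t ∘L V w t ∘L F t -
      Φs w t ∘L C c ∘L W w t ∘L Ψ w t :=
    ((hΦs.clm_comp (hΨ.const_clm_comp D₀)).add (hΦs.clm_comp ((hVd t ht).clm_comp_const (F t)))).sub
      (hΦs.clm_comp (((hWd t ht).clm_comp hΨ).const_clm_comp (C c)))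
  have hR : Tendsto (fun w => C t ∘L resolvent A w ∘L F t) (cobounded ℂ) (𝓝 0) := by
    have hcont : Continuous fun T : H →L[ℂ] H => C t ∘L T ∘L F t :=
      continuous_const.clm_comp (continuous_id.clm_comp continuous_const)
    have h₁ := (hcont.tendsto 0).comp (spectrum.resolvent_tendsto_cobounded (𝕜 := ℂ) A)
    rwa [ContinuousLinearMap.zero_comp, ContinuousLinearMap.comp_zero] at h₁
  have hfar : ∀ᶠ w in cobounded ℂ, w ∉ spectrum ℂ A :=
    isBounded_def.1 (spectrum.isBounded (𝕜 := ℂ) A)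
  -- The resolvent term vanishes at infinity, so the entire remainder inherits the limit `D`;
  -- Liouville then makes it constant.
  have hlim' : Tendsto (fun w => Φs w t ∘L D₀ ∘L Ψ w t + Φs w t ∘L V w t ∘L F t -
      Φs w t ∘L C c ∘L W w t ∘L Ψ w t) (cocompact ℂ) (𝓝 D) := by
    rw [← Metric.cobounded_eq_cocompact]
    have h₁ := hlim.sub hR
    rw [sub_zero] at h₁
    refine h₁.congr' ?_
    filter_upwards [hfar] with w hw
    rw [key w hw]; abel
  rw [key z hz, hent.apply_eq_of_tendsto_cocompact z hlim', add_comm]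

/-- The equations satisfied by the feedthrough operator `D`. -/
theorem feedthrough_equations (hI : I.OrdConnected)
    (h : IsPropagator K N I c Φ Ψ) (hs : IsPropagator Ks Ns I c Φs Ψs)
    (hC : HasACDeriv C (fun t => Ks t ∘L C t ∘L A + Ns t ∘L C t) I)
    (hF : HasACDeriv F (fun t => -(A ∘L F t ∘L K t + F t ∘L N t)) I) {D : ℝ → E →L[ℂ] Es}
    {G : ℂ → E →L[ℂ] Es} {z₁ z₂ : ℂ} (hne : z₁ ≠ z₂)
    (hD : ∀ z, z = z₁ ∨ z = z₂ → z ∉ spectrum ℂ A ∧ ∀ t ∈ I,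
      Φs z t ∘L G z ∘L Ψ z t = D t + C t ∘L resolvent A z ∘L F t) :
    HasACDeriv D (fun t => Ns t ∘L D t - D t ∘L N t + Ks t ∘L C t ∘L F t - C t ∘L F t ∘L K t) I ∧
      ∀ᵐ t ∂(volume.restrict I), Ks t ∘L D t = D t ∘L K t := by
  -- Solving the transfer identity for `D` at one fixed `z` makes `D` absolutely continuous. By `R A
  -- = A R = z R - 1` all resolvents cancel, leaving a derivative affine in `z`.
  have hder : ∀ z, z = z₁ ∨ z = z₂ → HasACDeriv D (fun t => z • (Ks t ∘L D t - D t ∘L K t) +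
      (Ns t ∘L D t - D t ∘L N t + Ks t ∘L C t ∘L F t - C t ∘L F t ∘L K t)) I := by
    intro z hz
    obtain ⟨hzA, hzD⟩ := hD z hz
    have h₁ := (((hs.hasACDeriv z).comp ((h.hasACDeriv_inv z).const_comp (G z))).sub
      (hC.comp (hF.const_comp (resolvent A z)))).congr hI (G := D) fun t ht => by
        rw [hzD t ht]; abel
    refine h₁.congr_deriv hI fun t ht => ?_
    have hRA : ∀ v, resolvent A z (A v) = z • resolvent A z v - v := fun v => by
      have h₂ := congrArg (fun T : H →L[ℂ] H => T v) (resolvent_mul_algebraMap_sub hzA)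
      simp only [mul_apply_eq_comp, sub_apply, Algebra.algebraMap_eq_smul_one, smul_apply,
        one_apply_eq_self, map_sub, map_smul] at h₂
      rw [sub_eq_iff_eq_add] at h₂
      rw [h₂, add_sub_cancel_left]
    have hAR : ∀ v, A (resolvent A z v) = z • resolvent A z v - v := fun v => by
      have h₂ := congrArg (fun T : H →L[ℂ] H => T v) (algebraMap_sub_mul_resolvent hzA)
      simp only [mul_apply_eq_comp, sub_apply, Algebra.algebraMap_eq_smul_one, smul_apply,
        one_apply_eq_self] at h₂
      rw [sub_eq_iff_eq_add] at h₂
      rw [h₂, add_sub_cancel_left]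
    have hT : ∀ v, Φs z t (G z (Ψ z t v)) = D t v + C t (resolvent A z (F t v)) := fun v => by
      simpa using congrArg (fun T : E →L[ℂ] Es => T v) (hzD t ht)
    ext v
    simp [hT, hRA, hAR]
    module
  have h₁ := hder z₁ (.inl rfl)
  have h₂ := hder z₂ (.inr rfl)
  -- The derivative of `D` does not depend on `z`, so equality at `z₁ ≠ z₂` kills the coefficient of
  -- `z`.
  have hlink : ∀ᵐ t ∂(volume.restrict I), Ks t ∘L D t = D t ∘L K t := by
    filter_upwards [h₁.hasDerivAt, h₂.hasDerivAt] with t d₁ d₂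
    have := add_right_cancel (d₁.unique d₂)
    rw [← sub_eq_zero, ← sub_smul, smul_eq_zero, sub_eq_zero, sub_eq_zero] at this
    exact this.resolve_left hne
  refine ⟨⟨h₁.locallyAC, ?_⟩, hlink⟩
  filter_upwards [h₁.hasDerivAt, hlink] with t d₁ hl
  simpa [hl] using d₁

end Transfer

/-! ### Realization at the base point and the main theorem -/

theorem IsIntertwining.exists_realization {E : Type uE} {Et : Type uEt} {Es : Type uEs}
    {Ets : Type uEts}
    [NormedAddCommGroup E] [InnerProductSpace ℂ E]
    [NormedAddCommGroup Et] [InnerProductSpace ℂ Et]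
    [NormedAddCommGroup Es] [InnerProductSpace ℂ Es] [CompleteSpace Es]
    [NormedAddCommGroup Ets] [InnerProductSpace ℂ Ets]
    {p : ODECoeff E Et} {q : ODECoeff Es Ets} {I : Set ℝ} {Ω : Set ℂ} {S : ℂ → ℝ → E →L[ℂ] Es}
    (hS : IsIntertwining p q I Ω S) (hp : p.Regular I) {t₀ : ℝ} (ht₀ : t₀ ∈ I) :
    ∃ (H : Type uEs) (_ : NormedAddCommGroup H) (_ : InnerProductSpace ℂ H) (_ : CompleteSpace H)
      (A₁ : H →L[ℂ] H) (B₀ : Et →L[ℂ] H) (C₀ : H →L[ℂ] Es) (D₀ : E →L[ℂ] Es),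
      ∀ᶠ z in cobounded ℂ, S z t₀ = realizationValue A₁ B₀ C₀ D₀ (p.σ₁ t₀) z := by
  obtain ⟨H, i₁, i₂, i₃, e, ev, shift, he, hev, hshift⟩ := exists_hilbert_shift Es
  obtain ⟨g, hg, hgS⟩ := hS.analytic_infty t₀ ht₀
  obtain ⟨A, B, C, D, h⟩ :=
    hg.exists_realization_of_shift he hev hshift (hp.invertible_σ₁ t₀ ht₀)
  refine ⟨H, i₁, i₂, i₃, A, B, C, D, ?_⟩
  filter_upwards [hgS, h] with z h₁ h₂
  rw [h₁, h₂]

theorem IsIntertwining.exists_tendsto {E Et Es Ets : Type*}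
    [NormedAddCommGroup E] [InnerProductSpace ℂ E]
    [NormedAddCommGroup Et] [InnerProductSpace ℂ Et]
    [NormedAddCommGroup Es] [InnerProductSpace ℂ Es]
    [NormedAddCommGroup Ets] [InnerProductSpace ℂ Ets]
    {p : ODECoeff E Et} {q : ODECoeff Es Ets} {I : Set ℝ} {Ω : Set ℂ} {S : ℂ → ℝ → E →L[ℂ] Es}
    (hS : IsIntertwining p q I Ω S) {t : ℝ} (ht : t ∈ I) :
    ∃ D, Tendsto (fun z => S z t) (cobounded ℂ) (𝓝 D) := by
  obtain ⟨g, hg, hgS⟩ := hS.analytic_infty t ht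
  exact ⟨g 0, (hg.continuousAt.tendsto.comp tendsto_inv₀_cobounded).congr'
    (hgS.mono fun z hz => hz.symm)⟩

theorem theorem8p1 {E : Type uE} {Et : Type uEt} {Es : Type uEs} {Ets : Type uEts}
    [NormedAddCommGroup E] [InnerProductSpace ℂ E] [CompleteSpace E]
    [NormedAddCommGroup Et] [InnerProductSpace ℂ Et] [CompleteSpace Et]
    [NormedAddCommGroup Es] [InnerProductSpace ℂ Es] [CompleteSpace Es]
    [NormedAddCommGroup Ets] [InnerProductSpace ℂ Ets] [CompleteSpace Ets]
    (I : Set ℝ) (hI : I.OrdConnected)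
    (p : ODECoeff E Et) (q : ODECoeff Es Ets) (hp : p.Regular I) (hq : q.Regular I)
    (Ω : Set ℂ) (S : ℂ → ℝ → E →L[ℂ] Es) (hS : IsIntertwining p q I Ω S)
    (t₀ : ℝ) (ht₀ : t₀ ∈ I) :
    -- the fundamental matrices of the input and the output ODE exist
    (∃ Φ : ℂ → ℝ → E →L[ℂ] E, p.IsFundamental I t₀ Φ) ∧
    (∃ Φs : ℂ → ℝ → Es →L[ℂ] Es, q.IsFundamental I t₀ Φs) ∧
    -- `S(·, t₀)` has a realization near `∞` on a Hilbert space
    (∃ (H : Type uEs) (_ : NormedAddCommGroup H) (_ : InnerProductSpace ℂ H) (_ : CompleteSpace H)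
      (A₁ : H →L[ℂ] H) (B₀ : Et →L[ℂ] H) (C₀ : H →L[ℂ] Es) (D₀ : E →L[ℂ] Es),
      ∀ᶠ z in cobounded ℂ, S z t₀ = realizationValue A₁ B₀ C₀ D₀ (p.σ₁ t₀) z) ∧
    -- every such realization yields a differential vessel with transfer function `S`
    (∀ (Φ : ℂ → ℝ → E →L[ℂ] E) (Φs : ℂ → ℝ → Es →L[ℂ] Es),
      p.IsFundamental I t₀ Φ → q.IsFundamental I t₀ Φs →
      ∀ (H : Type uH) [NormedAddCommGroup H] [InnerProductSpace ℂ H] [CompleteSpace H]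
        (A₁ : H →L[ℂ] H) (B₀ : Et →L[ℂ] H) (C₀ : H →L[ℂ] Es) (D₀ : E →L[ℂ] Es),
      (∀ᶠ z in cobounded ℂ, S z t₀ = realizationValue A₁ B₀ C₀ D₀ (p.σ₁ t₀) z) →
      ∃ V : DifferentialVessel p q I H,
        (∀ t ∈ I, V.A₁ t = A₁) ∧
        (∀ t ∈ I, V.A₂ t = 0) ∧
        -- contour integrals over all circles that surround the spectrum of `A₁`
        (∀ (c : ℂ) (r : ℝ), 0 < r → spectrum ℂ A₁ ⊆ Metric.ball c r → ∀ t ∈ I,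
          V.C t = (2 * Real.pi * Complex.I : ℂ)⁻¹ •
            ∮ z in C(c, r), Φs z t ∘L C₀ ∘L resolvent A₁ z) ∧
        (∀ (c : ℂ) (r : ℝ), 0 < r → spectrum ℂ A₁ ⊆ Metric.ball c r → ∀ t ∈ I,
          V.B t = (2 * Real.pi * Complex.I : ℂ)⁻¹ •
            ∮ z in C(c, r), resolvent A₁ z ∘L B₀ ∘L p.σ₁ t₀ ∘L
              (Φ z t).inverse ∘L (p.σ₁ t).inverse) ∧
        -- `D(t) = S(∞, t)`
        (∀ t ∈ I, Tendsto (fun z => S z t) (cobounded ℂ) (𝓝 (V.D t))) ∧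
        -- `S` is the transfer function in a neighbourhood of `∞` that does not depend on `t`
        (∀ᶠ z in cobounded ℂ, ∀ t ∈ I, S z t = V.transferFunction z t) ∧
        -- and at all `z` outside the spectrum at which the realization of `S(·, t₀)` is valid
        (∀ z ∈ Ω, z ∉ spectrum ℂ A₁ → S z t₀ = realizationValue A₁ B₀ C₀ D₀ (p.σ₁ t₀) z →
          ∀ t ∈ I, S z t = V.transferFunction z t)) := by
  obtain ⟨Φc, Ψc, hΦc⟩ := hp.exists_isPropagator hI ht₀
  obtain ⟨Φsc, Ψsc, hΦsc⟩ := hq.exists_isPropagator hI ht₀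
  refine ⟨⟨Φc, hp.isFundamental_of_isPropagator hI hΦc⟩,
    ⟨Φsc, hq.isFundamental_of_isPropagator hI hΦsc⟩, hS.exists_realization hp ht₀, ?_⟩
  intro Φ Φs hΦ hΦs H _ _ _ A B₀ C₀ D₀ hreal
  have eΦ : ∀ z, ∀ t ∈ I, Φ z t = Φc z t := fun z t ht => hp.isFundamental_eq hI ht₀ hΦc hΦ z ht
  have eΦs : ∀ z, ∀ t ∈ I, Φs z t = Φsc z t := fun z t ht =>
    hq.isFundamental_eq hI ht₀ hΦsc hΦs z ht
  have hK := hp.segmentIntegrable_normalSpectral hI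
  have hN := hp.segmentIntegrable_normalFree hI
  have hKs := hq.segmentIntegrable_normalSpectral hI
  have hNs := hq.segmentIntegrable_normalFree hI
  obtain ⟨C, hC0, hC⟩ := exists_outputOperator hI hKs hNs ht₀ A C₀
  obtain ⟨F, hF0, hF⟩ := exists_inputOperator hI hK hN ht₀ A (B₀ ∘L p.σ₁ t₀)
  obtain ⟨V, hVd, hV⟩ := hΦsc.exists_entire_output hI hKs ht₀ hC
  obtain ⟨W, hWd, hW⟩ := hΦc.exists_entire_input hI hK ht₀ hF
  -- Off `I` the limit is replaced by the dummy value `0`, so that `D` is a function on all of `ℝ`.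
  have hlim : ∀ t, ∃ D, t ∈ I → Tendsto (fun z => S z t) (cobounded ℂ) (𝓝 D) := fun t => by
    by_cases ht : t ∈ I
    · obtain ⟨D, hD⟩ := hS.exists_tendsto ht
      exact ⟨D, fun _ => hD⟩
    · exact ⟨0, fun h => absurd h ht⟩
  choose D hD using hlim
  have hfar : ∀ᶠ z in cobounded ℂ, z ∉ spectrum ℂ A :=
    isBounded_def.1 (spectrum.isBounded (𝕜 := ℂ) A)
  -- These conditions involve only `t₀`, whence a neighbourhood of infinity independent of `t`.
  have hgood : ∀ᶠ z in cobounded ℂ, z ∈ Ω ∧ z ∉ spectrum ℂ A ∧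
      S z t₀ = realizationValue A B₀ C₀ D₀ (p.σ₁ t₀) z := by
    filter_upwards [hS.nhds_infty, hfar, hreal] with z h₁ h₂ h₃ using ⟨h₁, h₂, h₃⟩
  have hevol : ∀ z ∈ Ω, S z t₀ = realizationValue A B₀ C₀ D₀ (p.σ₁ t₀) z → ∀ t ∈ I,
      S z t = Φsc z t ∘L (D₀ + C t₀ ∘L resolvent A z ∘L F t₀) ∘L Ψc z t :=
    fun z hz hr t ht => by
      rw [hS.eq_comp hI hp hq ht₀ hΦc hΦsc hz ht, hr, hC0, hF0]; rfl
  have htr : ∀ z ∈ Ω, z ∉ spectrum ℂ A →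
      S z t₀ = realizationValue A B₀ C₀ D₀ (p.σ₁ t₀) z → ∀ t ∈ I,
      S z t = D t + C t ∘L resolvent A z ∘L F t := fun z hz hzA hr t ht => by
    rw [hevol z hz hr t ht]
    refine eq_limit_add_transfer hI ht₀ hK hKs hΦc hΦsc hC hF ht ?_ hzA
    refine (hD t ht).congr' ?_
    filter_upwards [hgood] with w hw using hevol w hw.1 hw.2.2 t ht
  obtain ⟨z₁, hz₁⟩ := hgood.exists
  obtain ⟨z₂, hz₂, hne⟩ := (hgood.and (isBounded_def.1 (isBounded_singleton (x := z₁)))).exists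
  obtain ⟨hDd, hlink⟩ := feedthrough_equations hI hΦc hΦsc hC hF (D := D)
    (G := fun z => D₀ + C t₀ ∘L resolvent A z ∘L F t₀) (z₁ := z₁) (z₂ := z₂) (Ne.symm hne)
    (by
      have hgz : ∀ z, z ∈ Ω ∧ z ∉ spectrum ℂ A ∧
          S z t₀ = realizationValue A B₀ C₀ D₀ (p.σ₁ t₀) z → z ∉ spectrum ℂ A ∧ ∀ t ∈ I,
          Φsc z t ∘L (D₀ + C t₀ ∘L resolvent A z ∘L F t₀) ∘L Ψc z t =
            D t + C t ∘L resolvent A z ∘L F t := fun z hz =>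
        ⟨hz.2.1, fun t ht => by
          rw [← hevol z hz.1 hz.2.2 t ht, htr z hz.1 hz.2.1 hz.2.2 t ht]⟩
      rintro z (rfl | rfl)
      · exact hgz z hz₁
      · exact hgz z hz₂)
  have hmem : ∀ᵐ t ∂(volume.restrict I), t ∈ I := ae_restrict_mem hI.measurableSet
  have hσinv : LocallyAC (fun t => (p.σ₁ t).inverse) I :=
    hp.locallyAC_σ₁.inverse hI hp.invertible_σ₁
  have hBσ : ∀ t ∈ I, (F t ∘L (p.σ₁ t).inverse) ∘L p.σ₁ t = F t := fun t ht => by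
    rw [ContinuousLinearMap.comp_assoc, (hp.invertible_σ₁ t ht).inverse_comp_self,
      ContinuousLinearMap.comp_id]
  have hBF : HasACDeriv (fun t => (F t ∘L (p.σ₁ t).inverse) ∘L p.σ₁ t)
      (fun t => -(A ∘L F t ∘L p.normalSpectral t + F t ∘L p.normalFree t)) I := hF.congr hI hBσ
  let Ves : DifferentialVessel p q I H :=
    { A₁ := fun _ => A
      A₂ := fun _ => 0
      B := fun t => F t ∘L (p.σ₁ t).inverse
      C := C
      D := D
      -- The only choice compatible with the first linkage condition, `σ₁` being invertible.
      Dt := fun t => q.σ₁ t ∘L D t ∘L (p.σ₁ t).inverse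
      regular_input := hp
      regular_output := hq
      locallyAC_A₁ := LocallyAC.const I A
      locallyIntegrable_A₂ := (locallyIntegrable_zero).locallyIntegrableOn I
      locallyAC_Bσ₁ := hBF.locallyAC
      locallyAC_C := hC.locallyAC
      locallyAC_D := hDd.locallyAC
      locallyAC_Dt := hq.locallyAC_σ₁.comp (hDd.locallyAC.comp hσinv)
      lax := Eventually.of_forall fun t => by simpa using hasDerivAt_const t A
      input := by
        filter_upwards [hBF.hasDerivAt] with t ht
        refine ⟨_, ht, ?_⟩
        simp only [ODECoeff.normalSpectral, ODECoeff.normalFree, ContinuousLinearMap.zero_comp,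
          ContinuousLinearMap.comp_assoc]
        abel
      output := by
        filter_upwards [hC.hasDerivAt, hmem] with t ht htI
        refine ⟨_, ht, ?_⟩
        rw [ContinuousLinearMap.comp_zero, add_zero, ContinuousLinearMap.comp_add,
          ← ContinuousLinearMap.comp_assoc (q.σ₁ t), ← ContinuousLinearMap.comp_assoc (q.σ₁ t),
          hq.comp_normalSpectral htI, hq.comp_normalFree htI]
        abel
      linkage₁ := fun t ht => by
        rw [ContinuousLinearMap.comp_assoc, ContinuousLinearMap.comp_assoc,
          (hp.invertible_σ₁ t ht).inverse_comp_self, ContinuousLinearMap.comp_id]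
      linkage₂ := by
        filter_upwards [hlink, hmem] with t ht htI
        have h₁ := congrArg (fun T => q.σ₁ t ∘L T) ht
        simp only [← ContinuousLinearMap.comp_assoc, hq.comp_normalSpectral htI] at h₁
        rw [h₁]
        simp only [ODECoeff.normalSpectral, ContinuousLinearMap.comp_assoc]
      linkage₃ := by
        filter_upwards [hDd.hasDerivAt, hmem] with t ht htI
        refine ⟨_, ht, ?_⟩
        rw [hBσ t htI]
        simp only [ContinuousLinearMap.comp_add, ContinuousLinearMap.comp_sub,
          ← ContinuousLinearMap.comp_assoc (q.σ₁ t), hq.comp_normalSpectral htI,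
          hq.comp_normalFree htI]
        simp only [ODECoeff.normalSpectral, ODECoeff.normalFree, ContinuousLinearMap.comp_assoc]
        abel }
  have htf : ∀ z, ∀ t ∈ I, Ves.transferFunction z t = D t + C t ∘L resolvent A z ∘L F t :=
    fun z t ht => by
      change D t + C t ∘L resolvent A z ∘L (F t ∘L (p.σ₁ t).inverse) ∘L p.σ₁ t = _
      rw [hBσ t ht]
  refine ⟨Ves, fun _ _ => rfl, fun _ _ => rfl, fun c r hr hA t ht => ?_, fun c r hr hA t ht => ?_,
    fun t ht => hD t ht, ?_, fun z hz hzA hr t ht => ?_⟩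
  · have hd : Differentiable ℂ fun z => Φsc z t ∘L V z t :=
      ((hΦsc.entire t ht).differentiable t Set.right_mem_uIcc).clm_comp (hVd t ht)
    refine (inv_smul_circleIntegral_eq hr hA (ContinuousLinearMap.compL ℂ H H Es (C t)) hd
      fun z hz => ?_).symm
    rw [eΦs z t ht, ← hC0]
    exact comp_resolvent_eq hz (hΦsc.comp_inv z t ht) (hV z t ht)
  · have hd : Differentiable ℂ fun z => -(W z t ∘L Ψc z t) ∘L (p.σ₁ t).inverse :=
      (((hWd t ht).clm_comp
        ((hΦc.entire_inv t ht).differentiable t Set.right_mem_uIcc)).neg).clm_comp_const _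
    refine (inv_smul_circleIntegral_eq hr hA
      ((ContinuousLinearMap.compL ℂ Et H H).flip (F t ∘L (p.σ₁ t).inverse)) hd fun z hz => ?_).symm
    rw [eΦ z t ht, hΦc.inverse_eq z ht]
    have h₁ := resolvent_comp_eq hz (hΦc.comp_inv z t ht) (hW z t ht)
    rw [hF0] at h₁
    have h₂ := congrArg (fun T => T ∘L (p.σ₁ t).inverse) h₁
    simp only [ContinuousLinearMap.comp_assoc, ContinuousLinearMap.sub_comp] at h₂
    rw [h₂, sub_eq_add_neg]
    simp only [ContinuousLinearMap.flip_apply, ContinuousLinearMap.compL_apply,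
      ContinuousLinearMap.comp_assoc]
  · filter_upwards [hgood] with z hz t ht
    rw [htf z t ht, htr z hz.1 hz.2.1 hz.2.2 t ht]
  · rw [htf z t ht, htr z hz hzA hr t ht]
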